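/- A complex quasi-projective variety is a Zariski locally closed subset of a complex projective space (it may be reducible or empty), with regular maps as morphisms. A pair $(X,Y)$ consists of a complex quasi-projective variety $X$ and a constructible subset $Y\subseteq X$, i.e. a finite union of Zariski locally closed subvarieties; an isomorphism of pairs is an isomorphism of the ambient varieties carrying one subset onto the other. The Grothendieck ring $K_0^{\rm pairs}({\rm Var}_{\mathbb C})$ is the abelian group generated by the isomorphism classes $[(X,Y)]$ of pairs modulo the relations $$[(X,Y)]=[(Z,Y\cap Z)]+[(X\setminus Z,\,Y\cap(X\setminus Z))]$$ for Zariski closed $Z\subseteq X$, with the multiplication $$[(X_1,Y_1)]\cdot[(X_2,Y_2)]=[(X_1\times X_2,\,(X_1\times Y_2)\cup(Y_1\times X_2))]$$ and the unit $1=[({\rm pt},\emptyset)]$. For a pair $(X,Y)$ and $n\ge 0$ let $\Lambda^n(X,Y)$ be the pair consisting of the unordered configuration space $\Lambda^nX=(X^n\setminus\Delta)/S_n$, where $\Delta$ is the big diagonal ($n$-tuples with at least two coinciding points), and of the subset of those unordered $n$-tuples of distinct points of $X$ of which at least one belongs to $Y$. Then $\Lambda^n(X,Y)$ is again a pair of this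 kind (the quotient exists as a quasi-projective variety, the subset is constructible), unique up to isomorphism, and the series $$\lambda_{X,Y}(t)=1+\sum_{n=1}^{\infty}[\Lambda^n(X,Y)]\,t^n$$ define a (pre-)$\lambda$-structure on the ring $R=K_0^{\rm pairs}({\rm Var}_{\mathbb C})$: there is one and only one family of series $\lambda_a(t)\in 1+t\,R[[t]]$, $a\in R$, such that $\lambda_a(t)=1+at+\cdots$ and $\lambda_{a+b}(t)=\lambda_a(t)\,\lambda_b(t)$ for all $a,b\in R$, and $\lambda_{[(X,Y)]}(t)=\lambda_{X,Y}(t)$ for every pair $(X,Y)$. In particular the series are multiplicative with respect to disjoint union: $$\lambda_{X_1\sqcup X_2,\,Y_1\sqcup Y_2}(t)=\lambda_{X_1,Y_1}(t)\cdot\lambda_{X_2,Y_2}(t).$$ -/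

import Mathlib

noncomputable section

namespace VarPairs

open MvPolynomial Set

/-! ### Complex projective spaces with the Zariski topology -/

/-- The complex projective space with homogeneous coordinates indexed by `ι`. -/
def PSpace (ι : Type) : Type := Projectivization ℂ (ι → ℂ)

namespace PSpace

variable {ι κ : Type}

/-- The point `[v]` with homogeneous coordinates `v`. -/
def mk (v : ι → ℂ) (hv : v ≠ 0) : PSpace ι := Projectivization.mk ℂ v hv

/-- A vector of homogeneous coordinates of a point. -/
def coords (p : PSpace ι) : ι → ℂ := Projectivization.rep p

theorem coords_ne_zero (p : PSpace ι) : p.coords ≠ 0 := Projectivization.rep_nonzero p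

theorem mk_coords (p : PSpace ι) : mk p.coords p.coords_ne_zero = p := Projectivization.mk_rep p

theorem mk_eq_mk {v w : ι → ℂ} (hv : v ≠ 0) (hw : w ≠ 0) :
    mk v hv = mk w hw ↔ ∃ a : ℂ, a • w = v := Projectivization.mk_eq_mk_iff' ℂ v w hv hw

theorem coords_mk (v : ι → ℂ) (hv : v ≠ 0) : ∃ a : ℂ, a ≠ 0 ∧ (mk v hv).coords = a • v := by
  obtain ⟨a, ha⟩ := Projectivization.exists_smul_eq_mk_rep ℂ v hv
  exact ⟨a, a.ne_zero, ha.symm⟩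

end PSpace

/-- The set of points at which the form `F` does not vanish. -/
def nonvanishing {ι : Type} (F : MvPolynomial ι ℂ) : Set (PSpace ι) :=
  {p | eval p.coords F ≠ 0}

/-- The Zariski topology: its open sets are the unions of sets `F ≠ 0` for homogeneous `F`. -/
instance zariski (ι : Type) : TopologicalSpace (PSpace ι) :=
  TopologicalSpace.generateFrom
    {U | ∃ (F : MvPolynomial ι ℂ) (d : ℕ), F.IsHomogeneous d ∧ U = nonvanishing F}

section Zariski

variable {ι κ : Type}

theorem eval_smul_of_isHomogeneous {F : MvPolynomial ι ℂ} {d : ℕ} (hF : F.IsHomogeneous d)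
    (a : ℂ) (v : ι → ℂ) : eval (a • v) F = a ^ d * eval v F := by
  rw [eval_eq, eval_eq, Finset.mul_sum]
  refine Finset.sum_congr rfl fun m hm => ?_
  have h : ∑ i ∈ m.support, m i = d := (hF.degree_eq_sum_deg_support hm).symm
  simp only [Pi.smul_apply, smul_eq_mul, mul_pow, Finset.prod_mul_distrib,
    Finset.prod_pow_eq_pow_sum, h]
  ring

theorem mk_mem_nonvanishing {F : MvPolynomial ι ℂ} {d : ℕ} (hF : F.IsHomogeneous d)
    {v : ι → ℂ} (hv : v ≠ 0) : PSpace.mk v hv ∈ nonvanishing F ↔ eval v F ≠ 0 := by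
  obtain ⟨a, ha, h⟩ := PSpace.coords_mk v hv
  simp [nonvanishing, h, eval_smul_of_isHomogeneous hF, ha]

theorem isOpen_nonvanishing {F : MvPolynomial ι ℂ} {d : ℕ} (hF : F.IsHomogeneous d) :
    IsOpen (nonvanishing F) := .basic _ ⟨F, d, hF, rfl⟩

theorem exists_nonvanishing {U : Set (PSpace ι)} (hU : IsOpen U) {p : PSpace ι} (hp : p ∈ U) :
    ∃ (F : MvPolynomial ι ℂ) (d : ℕ), F.IsHomogeneous d ∧ p ∈ nonvanishing F ∧
      nonvanishing F ⊆ U := by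
  induction hU with
  | basic V hV =>
    obtain ⟨F, d, hF, rfl⟩ := hV
    exact ⟨F, d, hF, hp, subset_rfl⟩
  | univ => exact ⟨1, 0, isHomogeneous_one _ _, by simp [nonvanishing], subset_univ _⟩
  | inter V W _ _ hV hW =>
    obtain ⟨F, d, hF, hpF, hFV⟩ := hV hp.1
    obtain ⟨G, e, hG, hpG, hGW⟩ := hW hp.2
    refine ⟨F * G, d + e, hF.mul hG, by simpa [nonvanishing] using ⟨hpF, hpG⟩, fun q hq => ?_⟩
    simp only [nonvanishing, mem_ofPred_eq, map_mul, ne_eq, mul_eq_zero, not_or] at hq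
    exact ⟨hFV hq.1, hGW hq.2⟩
  | sUnion 𝒱 _ h =>
    obtain ⟨V, hV, hpV⟩ := hp
    obtain ⟨F, d, hF, hpF, hFV⟩ := h V hV hpV
    exact ⟨F, d, hF, hpF, hFV.trans (subset_sUnion_of_mem hV)⟩

/-- Constructible sets: finite unions of Zariski locally closed sets. -/
def IsConstructibleSet (Y : Set (PSpace ι)) : Prop :=
  ∃ 𝒮 : Set (Set (PSpace ι)), 𝒮.Finite ∧ (∀ s ∈ 𝒮, IsLocallyClosed s) ∧ ⋃₀ 𝒮 = Y

theorem isConstructibleSet_empty : IsConstructibleSet (∅ : Set (PSpace ι)) :=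
  ⟨∅, finite_empty, by simp, by simp⟩

theorem IsConstructibleSet.union {Y Z : Set (PSpace ι)} (hY : IsConstructibleSet Y)
    (hZ : IsConstructibleSet Z) : IsConstructibleSet (Y ∪ Z) := by
  obtain ⟨S, hS, hS', rfl⟩ := hY
  obtain ⟨T, hT, hT', rfl⟩ := hZ
  exact ⟨S ∪ T, hS.union hT, fun s hs => hs.elim (hS' s) (hT' s), sUnion_union _ _⟩

theorem IsConstructibleSet.inter {Y C : Set (PSpace ι)} (hY : IsConstructibleSet Y)
    (hC : IsLocallyClosed C) : IsConstructibleSet (Y ∩ C) := by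
  obtain ⟨S, hS, hS', rfl⟩ := hY
  refine ⟨(· ∩ C) '' S, hS.image _, ?_, ?_⟩
  · rintro _ ⟨s, hs, rfl⟩
    exact (hS' s hs).inter hC
  · rw [sUnion_image, sUnion_eq_biUnion, iUnion₂_inter]

end Zariski

/-! ### Regular maps -/

/-- Let `j` identify the points of `T` with points of a projective space. The map `f` from `T` to
a projective space is regular if near every point it is given, in homogeneous coordinates, by
forms of one and the same degree without common zeros. -/
def IsRegular {T ι κ : Type} (j : T → PSpace ι) (f : T → PSpace κ) : Prop :=
  ∀ t : T, ∃ (d : ℕ) (F : κ → MvPolynomial ι ℂ) (U : Set (PSpace ι)),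
    (∀ k, (F k).IsHomogeneous d) ∧ IsOpen U ∧ j t ∈ U ∧
    ∀ s : T, j s ∈ U → ∃ h : (fun k => eval (j s).coords (F k)) ≠ 0, f s = PSpace.mk _ h

section Regular

variable {T T' ι κ μ : Type}

theorem isRegular_self (j : T → PSpace ι) : IsRegular j j := fun t =>
  ⟨1, X, univ, fun k => isHomogeneous_X _ k, isOpen_univ, mem_univ _, fun s _ => by
    refine ⟨by simpa using (j s).coords_ne_zero, ?_⟩
    simpa using (j s).mk_coords.symm⟩

theorem IsRegular.exists_preimage {j : T → PSpace ι} {f : T → PSpace κ} (hf : IsRegular j f)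
    (t : T) {U : Set (PSpace κ)} (hU : IsOpen U) (ht : f t ∈ U) :
    ∃ V : Set (PSpace ι), IsOpen V ∧ j t ∈ V ∧ ∀ s, j s ∈ V → f s ∈ U := by
  obtain ⟨d, F, W, hF, hW, htW, h⟩ := hf t
  obtain ⟨G, e, hG, htG, hGU⟩ := exists_nonvanishing hU ht
  have key : ∀ s, j s ∈ W → (f s ∈ nonvanishing G ↔ j s ∈ nonvanishing (bind₁ F G)) := by
    intro s hs
    obtain ⟨h0, h1⟩ := h s hs
    rw [h1, mk_mem_nonvanishing hG, nonvanishing, mem_ofPred_eq, ← coe_aeval_eq_eval,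
      ← coe_aeval_eq_eval, RingHom.coe_coe, RingHom.coe_coe, aeval_bind₁]
  have hB : (bind₁ F G).IsHomogeneous (d * e) := hG.aeval F hF
  refine ⟨W ∩ nonvanishing (bind₁ F G), hW.inter (isOpen_nonvanishing hB),
    ⟨htW, (key t htW).1 htG⟩, fun s hs => hGU ((key s hs.1).2 hs.2)⟩

theorem IsRegular.comp {j : T → PSpace ι} {j' : T' → PSpace κ} {f : T → T'} {g : T' → PSpace μ}
    (hg : IsRegular j' g) (hf : IsRegular j (j' ∘ f)) : IsRegular j (g ∘ f) := by
  intro t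
  obtain ⟨e, G, W, hG, hW, htW, hgW⟩ := hg (f t)
  obtain ⟨d, F, U, hF, hU, htU, hfU⟩ := hf t
  obtain ⟨V, hV, htV, hVW⟩ := hf.exists_preimage t hW htW
  refine ⟨d * e, fun k => bind₁ F (G k), U ∩ V, fun k => (hG k).aeval F hF, hU.inter hV,
    ⟨htU, htV⟩, fun s hs => ?_⟩
  obtain ⟨h0, h1⟩ := hfU s hs.1
  obtain ⟨h2, h3⟩ := hgW (f s) (hVW s hs.2)
  have h1' : j' (f s) = PSpace.mk _ h0 := h1
  obtain ⟨a, ha, hc⟩ := PSpace.coords_mk _ h0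
  have hval : (fun k => eval (j' (f s)).coords (G k)) =
      a ^ e • fun k => eval (j s).coords (bind₁ F (G k)) := by
    funext k
    rw [h1', hc, eval_smul_of_isHomogeneous (hG k)]
    simp only [Pi.smul_apply, smul_eq_mul]
    congr 1
    rw [← coe_aeval_eq_eval, ← coe_aeval_eq_eval, RingHom.coe_coe, RingHom.coe_coe, aeval_bind₁]
  have h4 : (fun k => eval (j s).coords (bind₁ F (G k))) ≠ 0 := by
    intro h5
    rw [h5, smul_zero] at hval
    exact h2 hval
  refine ⟨h4, ?_⟩
  rw [Function.comp_apply, h3, PSpace.mk_eq_mk]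
  exact ⟨a ^ e, hval.symm⟩

/-- Relabelling the homogeneous coordinates. -/
def relabel (e : κ ≃ ι) : PSpace ι ≃ PSpace κ where
  toFun p := PSpace.mk (p.coords ∘ e) fun h => p.coords_ne_zero <| by
    funext i
    simpa using congrFun h (e.symm i)
  invFun p := PSpace.mk (p.coords ∘ e.symm) fun h => p.coords_ne_zero <| by
    funext i
    simpa using congrFun h (e i)
  left_inv p := by
    conv_rhs => rw [← p.mk_coords]
    rw [PSpace.mk_eq_mk]
    obtain ⟨a, _, ha⟩ := PSpace.coords_mk (p.coords ∘ e) (fun h => p.coords_ne_zero <| by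
      funext i
      simpa using congrFun h (e.symm i))
    exact ⟨a, by rw [ha]; ext i; simp⟩
  right_inv p := by
    conv_rhs => rw [← p.mk_coords]
    rw [PSpace.mk_eq_mk]
    obtain ⟨a, _, ha⟩ := PSpace.coords_mk (p.coords ∘ e.symm) (fun h => p.coords_ne_zero <| by
      funext i
      simpa using congrFun h (e i))
    exact ⟨a, by rw [ha]; ext i; simp⟩

theorem relabel_mk (e : κ ≃ ι) (v : ι → ℂ) (hv : v ≠ 0) (hv' : v ∘ e ≠ 0) :
    relabel e (PSpace.mk v hv) = PSpace.mk (v ∘ e) hv' := by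
  obtain ⟨a, _, ha⟩ := PSpace.coords_mk v hv
  change PSpace.mk _ _ = _
  rw [PSpace.mk_eq_mk]
  exact ⟨a, by rw [ha]; rfl⟩

theorem isRegular_relabel (e : κ ≃ ι) (j : T → PSpace ι) : IsRegular j (relabel e ∘ j) := fun _ =>
  ⟨1, fun k => X (e k), univ, fun k => isHomogeneous_X _ _, isOpen_univ, mem_univ _, fun s _ => by
    refine ⟨fun h => (j s).coords_ne_zero ?_, ?_⟩
    · funext i
      simpa using congrFun h (e.symm i)
    · simp [relabel, Function.comp_def]⟩

end Regular

/-! ### The Segre embeddings -/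

section Segre

variable {ι κ μ : Type}

theorem segre_aux {v : ι → ℂ} {w : κ → ℂ} (hv : v ≠ 0) (hw : w ≠ 0) :
    (fun ik : ι × κ => v ik.1 * w ik.2) ≠ 0 := by
  obtain ⟨i, hi⟩ := Function.ne_iff.1 hv
  obtain ⟨k, hk⟩ := Function.ne_iff.1 hw
  exact Function.ne_iff.2 ⟨(i, k), mul_ne_zero hi hk⟩

/-- The Segre embedding of the product of two projective spaces. -/
def segre (p : PSpace ι) (q : PSpace κ) : PSpace (ι × κ) :=
  PSpace.mk (fun ik => p.coords ik.1 * q.coords ik.2) (segre_aux p.coords_ne_zero q.coords_ne_zero)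

/-- The Segre embedding of the `n`-th Cartesian power of a projective space. -/
def segrePow {n : ℕ} (p : Fin n → PSpace ι) : PSpace (Fin n → ι) :=
  PSpace.mk (fun m => ∏ i, (p i).coords (m i)) <| by
    choose m hm using fun i => Function.ne_iff.1 (p i).coords_ne_zero
    exact Function.ne_iff.2 ⟨m, Finset.prod_ne_zero_iff.2 fun i _ => hm i⟩

theorem segre_mk {v : ι → ℂ} {w : κ → ℂ} (hv : v ≠ 0) (hw : w ≠ 0) :
    segre (PSpace.mk v hv) (PSpace.mk w hw) = PSpace.mk _ (segre_aux hv hw) := by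
  obtain ⟨a, _, ha⟩ := PSpace.coords_mk v hv
  obtain ⟨b, _, hb⟩ := PSpace.coords_mk w hw
  rw [segre, PSpace.mk_eq_mk]
  refine ⟨a * b, ?_⟩
  rw [ha, hb]
  ext x
  simp only [Pi.smul_apply, smul_eq_mul]
  ring

theorem segre_injective {p p' : PSpace ι} {q q' : PSpace κ} (h : segre p q = segre p' q') :
    p = p' ∧ q = q' := by
  rw [segre, segre, PSpace.mk_eq_mk] at h
  obtain ⟨a, ha⟩ := h
  have key : ∀ i k, a * (p'.coords i * q'.coords k) = p.coords i * q.coords k :=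
    fun i k => congrFun ha (i, k)
  constructor
  · rw [← p.mk_coords, ← p'.mk_coords, PSpace.mk_eq_mk]
    obtain ⟨k, hk⟩ := Function.ne_iff.1 q.coords_ne_zero
    refine ⟨a * q'.coords k / q.coords k, ?_⟩
    ext i
    have := key i k
    simp only [Pi.smul_apply, smul_eq_mul]
    rw [div_mul_eq_mul_div, div_eq_iff (by simpa using hk), ← this]
    ring
  · rw [← q.mk_coords, ← q'.mk_coords, PSpace.mk_eq_mk]
    obtain ⟨i, hi⟩ := Function.ne_iff.1 p.coords_ne_zero
    refine ⟨a * p'.coords i / p.coords i, ?_⟩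
    ext k
    have := key i k
    simp only [Pi.smul_apply, smul_eq_mul]
    rw [div_mul_eq_mul_div, div_eq_iff (by simpa using hi), mul_comm (q.coords k), ← this]
    ring

theorem relabel_segre_comm (p : PSpace ι) (q : PSpace κ) :
    relabel (Equiv.prodComm κ ι) (segre p q) = segre q p := by
  have hne := segre_aux q.coords_ne_zero p.coords_ne_zero
  have : (fun ik : ι × κ => p.coords ik.1 * q.coords ik.2) ∘ Equiv.prodComm κ ι =
      fun ki : κ × ι => q.coords ki.1 * p.coords ki.2 := by
    ext x
    simp [mul_comm]
  rw [segre, relabel_mk _ _ _ (by rw [this]; exact hne), segre]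
  congr 1

theorem relabel_segre_assoc (p : PSpace ι) (q : PSpace κ) (r : PSpace μ) :
    relabel (Equiv.prodAssoc ι κ μ).symm (segre (segre p q) r) = segre p (segre q r) := by
  have hl : segre (segre p q) r = PSpace.mk _
      (segre_aux (segre_aux p.coords_ne_zero q.coords_ne_zero) r.coords_ne_zero) := by
    rw [← segre_mk (segre_aux p.coords_ne_zero q.coords_ne_zero) r.coords_ne_zero, r.mk_coords]
    rfl
  have hr : segre p (segre q r) = PSpace.mk _
      (segre_aux p.coords_ne_zero (segre_aux q.coords_ne_zero r.coords_ne_zero)) := by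
    rw [← segre_mk p.coords_ne_zero (segre_aux q.coords_ne_zero r.coords_ne_zero), p.mk_coords]
    rfl
  rw [hl, hr]
  have : (fun x : (ι × κ) × μ => p.coords x.1.1 * q.coords x.1.2 * r.coords x.2) ∘
      (Equiv.prodAssoc ι κ μ).symm =
      fun x : ι × κ × μ => p.coords x.1 * (q.coords x.2.1 * r.coords x.2.2) := by
    ext x
    simp [mul_assoc]
  rw [relabel_mk _ _ _ (by
    rw [this]
    exact segre_aux p.coords_ne_zero (segre_aux q.coords_ne_zero r.coords_ne_zero))]
  congr 1

theorem relabel_segre_unit (p : PSpace Unit) (q : PSpace κ) :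
    relabel (Equiv.punitProd κ).symm (segre p q) = q := by
  have hp : p.coords () ≠ 0 := fun h => p.coords_ne_zero (funext fun _ => h)
  have : (fun x : Unit × κ => p.coords x.1 * q.coords x.2) ∘ (Equiv.punitProd κ).symm =
      p.coords () • q.coords := by
    ext x
    simp
  rw [segre, relabel_mk _ _ _ (by rw [this]; exact smul_ne_zero hp q.coords_ne_zero)]
  conv_rhs => rw [← q.mk_coords]
  rw [PSpace.mk_eq_mk]
  exact ⟨p.coords (), this.symm⟩

theorem exists_isOpen_segre_left {U : Set (PSpace ι)} (hU : IsOpen U) :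
    ∃ U' : Set (PSpace (ι × κ)), IsOpen U' ∧ ∀ p q, segre p q ∈ U' ↔ p ∈ U := by
  refine ⟨⋃₀ {V | ∃ (F : MvPolynomial ι ℂ) (d : ℕ) (k : κ), F.IsHomogeneous d ∧
    nonvanishing F ⊆ U ∧ V = nonvanishing (rename (fun i => (i, k)) F)}, ?_, fun p q => ?_⟩
  · refine isOpen_sUnion ?_
    rintro V ⟨F, d, k, hF, -, rfl⟩
    exact isOpen_nonvanishing hF.rename_isHomogeneous
  · have key : ∀ (F : MvPolynomial ι ℂ) (d : ℕ) (k : κ), F.IsHomogeneous d →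
        (segre p q ∈ nonvanishing (rename (fun i => (i, k)) F) ↔
          q.coords k ^ d * eval p.coords F ≠ 0) := by
      intro F d k hF
      rw [segre, mk_mem_nonvanishing hF.rename_isHomogeneous, eval_rename,
        ← eval_smul_of_isHomogeneous hF]
      have : ((fun ik : ι × κ => p.coords ik.1 * q.coords ik.2) ∘ fun i => (i, k)) =
          q.coords k • p.coords := by
        ext i
        simp [mul_comm]
      rw [this]
    constructor
    · rintro ⟨V, ⟨F, d, k, hF, hFU, rfl⟩, hV⟩
      exact hFU (right_ne_zero_of_mul ((key F d k hF).1 hV))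
    · intro hp
      obtain ⟨F, d, hF, hpF, hFU⟩ := exists_nonvanishing hU hp
      obtain ⟨k, hk⟩ := Function.ne_iff.1 q.coords_ne_zero
      exact ⟨_, ⟨F, d, k, hF, hFU, rfl⟩, (key F d k hF).2 (mul_ne_zero (pow_ne_zero _ hk) hpF)⟩

theorem isOpen_preimage_relabel (e : κ ≃ ι) {S : Set (PSpace κ)} (hS : IsOpen S) :
    IsOpen (relabel e ⁻¹' S) := by
  refine isOpen_iff_forall_mem_open.2 fun p hp => ?_
  obtain ⟨V, hV, hpV, h⟩ := (isRegular_relabel e (id : PSpace ι → _)).exists_preimage p hS hp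
  exact ⟨V, fun q hq => h q hq, hV, hpV⟩

theorem exists_isOpen_segre_right {U : Set (PSpace κ)} (hU : IsOpen U) :
    ∃ U' : Set (PSpace (ι × κ)), IsOpen U' ∧ ∀ p q, segre p q ∈ U' ↔ q ∈ U := by
  obtain ⟨U', hU', h⟩ := exists_isOpen_segre_left (κ := ι) hU
  refine ⟨relabel (Equiv.prodComm κ ι) ⁻¹' U', isOpen_preimage_relabel _ hU',
    fun p q => ?_⟩
  rw [mem_preimage, relabel_segre_comm, h]

theorem isClosed_range_segre : IsClosed {z : PSpace (ι × κ) | ∃ p q, segre p q = z} := by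
  have heq : {z : PSpace (ι × κ) | ∃ p q, segre p q = z} =
      ⋂ (i : ι) (k : κ) (i' : ι) (k' : κ),
        (nonvanishing (X (i, k) * X (i', k') - X (i, k') * X (i', k) :
          MvPolynomial (ι × κ) ℂ))ᶜ := by
    have hh : ∀ (i : ι) (k : κ) (i' : ι) (k' : κ),
        (X (i, k) * X (i', k') - X (i, k') * X (i', k) :
          MvPolynomial (ι × κ) ℂ).IsHomogeneous 2 := fun i k i' k' =>
      ((isHomogeneous_X _ _).mul (isHomogeneous_X _ _)).sub
        ((isHomogeneous_X _ _).mul (isHomogeneous_X _ _))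
    ext z
    simp only [mem_ofPred_eq, mem_iInter, mem_compl_iff]
    constructor
    · rintro ⟨p, q, rfl⟩ i k i' k'
      rw [segre, mk_mem_nonvanishing (hh i k i' k'), not_not]
      simp only [map_sub, map_mul, eval_X]
      ring
    · intro h
      have hz : ∀ i k i' k', z.coords (i, k) * z.coords (i', k') =
          z.coords (i, k') * z.coords (i', k) := by
        intro i k i' k'
        have := h i k i' k'
        simp only [nonvanishing, mem_ofPred_eq, not_not, map_sub, map_mul, eval_X] at this
        exact sub_eq_zero.1 this
      obtain ⟨⟨i₀, k₀⟩, h0⟩ := Function.ne_iff.1 z.coords_ne_zero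
      refine ⟨PSpace.mk (fun i => z.coords (i, k₀)) (Function.ne_iff.2 ⟨i₀, h0⟩),
        PSpace.mk (fun k => z.coords (i₀, k)) (Function.ne_iff.2 ⟨k₀, h0⟩), ?_⟩
      conv_rhs => rw [← z.mk_coords]
      rw [segre_mk, PSpace.mk_eq_mk]
      refine ⟨z.coords (i₀, k₀), ?_⟩
      ext ⟨i, k⟩
      simp only [Pi.smul_apply, smul_eq_mul]
      rw [hz i₀ k₀ i k]
      ring
  rw [heq]
  refine isClosed_iInter fun i => isClosed_iInter fun k => isClosed_iInter fun i' =>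
    isClosed_iInter fun k' => (isOpen_nonvanishing (d := 2) ?_).isClosed_compl
  exact ((isHomogeneous_X _ _).mul (isHomogeneous_X _ _)).sub
    ((isHomogeneous_X _ _).mul (isHomogeneous_X _ _))

theorem isLocallyClosed_segre {S : Set (PSpace ι)} {S' : Set (PSpace κ)} (hS : IsLocallyClosed S)
    (hS' : IsLocallyClosed S') : IsLocallyClosed (image2 segre S S') := by
  obtain ⟨U, C, hU, hC, rfl⟩ := hS
  obtain ⟨U', C', hU', hC', rfl⟩ := hS'
  obtain ⟨V, hV, hVU⟩ := exists_isOpen_segre_left (κ := κ) hU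
  obtain ⟨D, hD, hDC⟩ := exists_isOpen_segre_left (κ := κ) hC.isOpen_compl
  obtain ⟨V', hV', hVU'⟩ := exists_isOpen_segre_right (ι := ι) hU'
  obtain ⟨D', hD', hDC'⟩ := exists_isOpen_segre_right (ι := ι) hC'.isOpen_compl
  refine ⟨V ∩ V', {z | ∃ p q, segre p q = z} ∩ (Dᶜ ∩ D'ᶜ), hV.inter hV',
    isClosed_range_segre.inter (hD.isClosed_compl.inter hD'.isClosed_compl), ?_⟩
  ext z
  constructor
  · rintro ⟨p, hp, q, hq, rfl⟩
    refine ⟨⟨(hVU p q).2 hp.1, (hVU' p q).2 hq.1⟩, ⟨p, q, rfl⟩, ?_, ?_⟩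
    · exact fun h => (hDC p q).1 h hp.2
    · exact fun h => (hDC' p q).1 h hq.2
  · rintro ⟨⟨h1, h2⟩, ⟨p, q, rfl⟩, h3, h4⟩
    refine ⟨p, ⟨(hVU p q).1 h1, ?_⟩, q, ⟨(hVU' p q).1 h2, ?_⟩, rfl⟩
    · by_contra h
      exact h3 ((hDC p q).2 h)
    · by_contra h
      exact h4 ((hDC' p q).2 h)

theorem isConstructibleSet_segre {S : Set (PSpace ι)} {S' : Set (PSpace κ)}
    (hS : IsConstructibleSet S) (hS' : IsConstructibleSet S') :
    IsConstructibleSet (image2 segre S S') := by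
  obtain ⟨A, hA, hA', rfl⟩ := hS
  obtain ⟨B, hB, hB', rfl⟩ := hS'
  refine ⟨image2 (image2 segre) A B, hA.image2 _ hB, ?_, ?_⟩
  · rintro _ ⟨a, ha, b, hb, rfl⟩
    exact isLocallyClosed_segre (hA' a ha) (hB' b hb)
  · ext z
    constructor
    · rintro ⟨_, ⟨a, ha, b, hb, rfl⟩, p, hp, q, hq, rfl⟩
      exact ⟨p, ⟨a, ha, hp⟩, q, ⟨b, hb, hq⟩, rfl⟩
    · rintro ⟨p, ⟨a, ha, hp⟩, q, ⟨b, hb, hq⟩, rfl⟩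
      exact ⟨_, ⟨a, ha, b, hb, rfl⟩, p, hp, q, hq, rfl⟩

theorem segre_eq (p : PSpace ι) (q : PSpace κ) : segre p q =
    PSpace.mk _ (segre_aux p.coords_ne_zero q.coords_ne_zero) := rfl

theorem isRegular_segre {T T' T'' ι' κ' : Type} {j : T → PSpace ι} {j' : T' → PSpace κ}
    {f : T → PSpace ι'} {f' : T' → PSpace κ'} (hf : IsRegular j f) (hf' : IsRegular j' f')
    (g : T'' → T) (g' : T'' → T') :
    IsRegular (fun t => segre (j (g t)) (j' (g' t))) (fun t => segre (f (g t)) (f' (g' t))) := by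
  intro t
  obtain ⟨d, F, U, hF, hU, htU, hfU⟩ := hf (g t)
  obtain ⟨d', F', U', hF', hU', htU', hfU'⟩ := hf' (g' t)
  obtain ⟨V, hV, hVU⟩ := exists_isOpen_segre_left (κ := κ) hU
  obtain ⟨V', hV', hVU'⟩ := exists_isOpen_segre_right (ι := ι) hU'
  obtain ⟨i, hi⟩ := Function.ne_iff.1 (j (g t)).coords_ne_zero
  obtain ⟨k, hk⟩ := Function.ne_iff.1 (j' (g' t)).coords_ne_zero
  have hX : (X (i, k) : MvPolynomial (ι × κ) ℂ).IsHomogeneous 1 := isHomogeneous_X _ _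
  refine ⟨d + d', fun x => rename (fun a => (a, k)) (F x.1) * rename (fun b => (i, b)) (F' x.2),
    nonvanishing (X (i, k)) ∩ (V ∩ V'),
    fun x => (hF x.1).rename_isHomogeneous.mul (hF' x.2).rename_isHomogeneous,
    (isOpen_nonvanishing hX).inter (hV.inter hV'), ⟨?_, (hVU _ _).2 htU, (hVU' _ _).2 htU'⟩,
    fun s hs => ?_⟩
  · beta_reduce
    rw [segre_eq, mk_mem_nonvanishing hX]
    simpa using ⟨hi, hk⟩
  · obtain ⟨hs1, hs2, hs3⟩ := hs
    beta_reduce at hs1 hs2 hs3 ⊢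
    rw [segre_eq, mk_mem_nonvanishing hX] at hs1
    simp only [eval_X] at hs1
    obtain ⟨h0, h1⟩ := hfU _ ((hVU _ _).1 hs2)
    obtain ⟨h0', h1'⟩ := hfU' _ ((hVU' _ _).1 hs3)
    obtain ⟨c, hc, hcoords⟩ := PSpace.coords_mk _
      (segre_aux (j (g s)).coords_ne_zero (j' (g' s)).coords_ne_zero)
    set p := (j (g s)).coords with hp
    set q := (j' (g' s)).coords with hq
    have hval : (fun x : ι' × κ' => eval (segre (j (g s)) (j' (g' s))).coords
        (rename (fun a => (a, k)) (F x.1) * rename (fun b => (i, b)) (F' x.2))) =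
        ((c * q k) ^ d * (c * p i) ^ d') • fun x : ι' × κ' =>
          eval p (F x.1) * eval q (F' x.2) := by
      ext x
      rw [segre_eq, hcoords]
      have e1 : ((c • fun ik : ι × κ => p ik.1 * q ik.2) ∘ fun a => (a, k)) = (c * q k) • p := by
        ext a
        simp only [Function.comp_apply, Pi.smul_apply, smul_eq_mul]
        ring
      have e2 : ((c • fun ik : ι × κ => p ik.1 * q ik.2) ∘ fun b => (i, b)) = (c * p i) • q := by
        ext b
        simp only [Function.comp_apply, Pi.smul_apply, smul_eq_mul]
        ring
      rw [map_mul, eval_rename, eval_rename, e1, e2, eval_smul_of_isHomogeneous (hF _),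
        eval_smul_of_isHomogeneous (hF' _)]
      simp only [Pi.smul_apply, smul_eq_mul]
      ring
    have hne : (c * q k) ^ d * (c * p i) ^ d' ≠ 0 :=
      mul_ne_zero (pow_ne_zero _ (mul_ne_zero hc (right_ne_zero_of_mul hs1)))
        (pow_ne_zero _ (mul_ne_zero hc (left_ne_zero_of_mul hs1)))
    refine ⟨by rw [hval]; exact smul_ne_zero hne (segre_aux h0 h0'), ?_⟩
    rw [h1, h1', segre_mk, PSpace.mk_eq_mk]
    refine ⟨((c * q k) ^ d * (c * p i) ^ d')⁻¹, ?_⟩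
    rw [hval, smul_smul, inv_mul_cancel₀ hne, one_smul]

end Segre

/-! ### Pairs of quasi-projective varieties -/

/-- A complex quasi-projective variety (possibly reducible, possibly empty): a Zariski locally
closed subset of a projective space. -/
structure QPVariety where
  /-- The index set of the homogeneous coordinates. -/
  ι : Type
  [fin : Fintype ι]
  /-- The set of points. -/
  X : Set (PSpace ι)
  isLocallyClosed : IsLocallyClosed X

/-- The points of a variety, as points of the projective space. -/
abbrev QPVariety.val (V : QPVariety) : V.X → PSpace V.ι := Subtype.val

/-- A pair `(X, Y)`: a complex quasi-projective variety `X` and a constructible subset `Y`, that is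
a finite union of locally closed subvarieties of `X`. -/
structure VarPair extends QPVariety where
  /-- The subvariety of the pair. -/
  Y : Set (PSpace ι)
  subset : Y ⊆ X
  isConstructible : IsConstructibleSet Y

namespace VarPair

/-- Two pairs are isomorphic if there is an isomorphism of the ambient varieties (a regular
bijection with regular inverse) that carries one subvariety onto the other. -/
def Iso (P Q : VarPair) : Prop :=
  ∃ e : P.X ≃ Q.X, IsRegular P.val (Q.val ∘ e) ∧ IsRegular Q.val (P.val ∘ e.symm) ∧
    ∀ x : P.X, (x : PSpace P.ι) ∈ P.Y ↔ (e x : PSpace Q.ι) ∈ Q.Y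

theorem Iso.refl (P : VarPair) : Iso P P :=
  ⟨Equiv.refl _, isRegular_self _, isRegular_self _, fun _ => Iff.rfl⟩

theorem Iso.symm {P Q : VarPair} : Iso P Q → Iso Q P := by
  rintro ⟨e, h1, h2, h3⟩
  exact ⟨e.symm, h2, h1, fun x => by rw [h3, Equiv.apply_symm_apply]⟩

theorem Iso.trans {P Q R : VarPair} : Iso P Q → Iso Q R → Iso P R := by
  rintro ⟨e, h1, h2, h3⟩ ⟨e', h1', h2', h3'⟩
  exact ⟨e.trans e', h1'.comp h1, h2.comp h2', fun x => (h3 x).trans (h3' (e x))⟩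

instance isoSetoid : Setoid VarPair := ⟨Iso, Iso.refl, Iso.symm, Iso.trans⟩

/-- The pair `(X ∩ C, Y ∩ C)` cut out by a locally closed subset `C` of the projective space. -/
abbrev restrict (P : VarPair) (C : Set (PSpace P.ι)) (hC : IsLocallyClosed C) : VarPair where
  ι := P.ι
  fin := P.fin
  X := P.X ∩ C
  isLocallyClosed := P.isLocallyClosed.inter hC
  Y := P.Y ∩ C
  subset := inter_subset_inter_left _ P.subset
  isConstructible := P.isConstructible.inter hC

/-- The pair `(pt, ∅)`. -/
abbrev one : VarPair where
  ι := Unit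
  fin := inferInstance
  X := univ
  isLocallyClosed := isOpen_univ.isLocallyClosed
  Y := ∅
  subset := empty_subset _
  isConstructible := isConstructibleSet_empty

theorem isConstructibleSet_ambient (P : VarPair) : IsConstructibleSet P.X :=
  ⟨{P.X}, finite_singleton _, by rintro _ rfl; exact P.isLocallyClosed, sUnion_singleton _⟩

/-- The product `(X₁ × X₂, (X₁ × Y₂) ∪ (Y₁ × X₂))`, embedded by the Segre map. -/
abbrev prod (P Q : VarPair) : VarPair where
  ι := P.ι × Q.ι
  fin := @instFintypeProd _ _ P.fin Q.fin
  X := image2 segre P.X Q.X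
  isLocallyClosed := isLocallyClosed_segre P.isLocallyClosed Q.isLocallyClosed
  Y := image2 segre P.X Q.Y ∪ image2 segre P.Y Q.X
  subset := union_subset (image2_subset_left Q.subset) (image2_subset_right P.subset)
  isConstructible :=
    (isConstructibleSet_segre P.isConstructibleSet_ambient Q.isConstructible).union
      (isConstructibleSet_segre P.isConstructible Q.isConstructibleSet_ambient)

theorem segre_mem_prod_X (P Q : VarPair) (p : PSpace P.ι) (q : PSpace Q.ι) :
    segre p q ∈ (P.prod Q).X ↔ p ∈ P.X ∧ q ∈ Q.X := by
  constructor
  · rintro ⟨p', hp, q', hq, h⟩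
    obtain ⟨rfl, rfl⟩ := segre_injective h
    exact ⟨hp, hq⟩
  · exact fun h => mem_image2_of_mem h.1 h.2

theorem segre_mem_prod_Y (P Q : VarPair) (p : PSpace P.ι) (q : PSpace Q.ι) :
    segre p q ∈ (P.prod Q).Y ↔ (p ∈ P.X ∧ q ∈ Q.Y) ∨ (p ∈ P.Y ∧ q ∈ Q.X) := by
  constructor
  · rintro (⟨p', hp, q', hq, h⟩ | ⟨p', hp, q', hq, h⟩) <;> obtain ⟨rfl, rfl⟩ := segre_injective h
    · exact Or.inl ⟨hp, hq⟩
    · exact Or.inr ⟨hp, hq⟩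
  · rintro (h | h)
    · exact Or.inl (mem_image2_of_mem h.1 h.2)
    · exact Or.inr (mem_image2_of_mem h.1 h.2)

/-- The points of the product are the pairs of points. -/
def prodEquiv (P Q : VarPair) : P.X × Q.X ≃ (P.prod Q).X :=
  Equiv.ofBijective (fun x => ⟨segre x.1.1 x.2.1, mem_image2_of_mem x.1.2 x.2.2⟩) <| by
    constructor
    · rintro ⟨a, b⟩ ⟨a', b'⟩ h
      obtain ⟨h1, h2⟩ := segre_injective (Subtype.ext_iff.1 h)
      exact Prod.ext (Subtype.ext h1) (Subtype.ext h2)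
    · rintro ⟨_, p, hp, q, hq, rfl⟩
      exact ⟨(⟨p, hp⟩, ⟨q, hq⟩), rfl⟩

theorem isRegular_prodEquiv {P P' Q Q' : VarPair} {f : P.X → P'.X} {g : Q.X → Q'.X}
    (hf : IsRegular P.val (P'.val ∘ f)) (hg : IsRegular Q.val (Q'.val ∘ g)) :
    IsRegular (P.prod Q).val
      ((P'.prod Q').val ∘ fun z => prodEquiv P' Q' (Prod.map f g ((prodEquiv P Q).symm z))) := by
  have h := isRegular_segre hf hg (fun z => ((prodEquiv P Q).symm z).1)
    (fun z => ((prodEquiv P Q).symm z).2)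
  have h1 : (fun z : (P.prod Q).X => segre (P.val ((prodEquiv P Q).symm z).1)
      (Q.val ((prodEquiv P Q).symm z).2)) = (P.prod Q).val := by
    funext z
    exact congrArg Subtype.val ((prodEquiv P Q).apply_symm_apply z)
  rw [h1] at h
  exact h

theorem prod_iso {P P' Q Q' : VarPair} : Iso P P' → Iso Q Q' → Iso (P.prod Q) (P'.prod Q') := by
  rintro ⟨e, h1, h2, h3⟩ ⟨e', h1', h2', h3'⟩
  refine ⟨(prodEquiv P Q).symm.trans ((e.prodCongr e').trans (prodEquiv P' Q')),
    isRegular_prodEquiv h1 h1', isRegular_prodEquiv h2 h2', fun z => ?_⟩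
  obtain ⟨⟨x, y⟩, rfl⟩ := (prodEquiv P Q).surjective z
  simp only [Equiv.trans_apply, Equiv.symm_apply_apply]
  change segre _ _ ∈ _ ↔ segre _ _ ∈ _
  rw [segre_mem_prod_Y, segre_mem_prod_Y]
  simp [h3, h3']

theorem iso_of_relabel {P Q : VarPair} (e : Q.ι ≃ P.ι)
    (hX : ∀ p, p ∈ P.X ↔ relabel e p ∈ Q.X) (hY : ∀ p ∈ P.X, p ∈ P.Y ↔ relabel e p ∈ Q.Y) :
    Iso P Q := by
  have hsymm : ∀ q, (relabel e).symm q = relabel e.symm q := fun q => rfl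
  refine ⟨(relabel e).subtypeEquiv hX, isRegular_relabel e _, ?_, fun x => hY x x.2⟩
  exact isRegular_relabel e.symm _

theorem prod_comm (P Q : VarPair) : Iso (P.prod Q) (Q.prod P) := by
  have hback : ∀ z, relabel (Equiv.prodComm P.ι Q.ι) (relabel (Equiv.prodComm Q.ι P.ι) z) = z :=
    fun z => (relabel (Equiv.prodComm Q.ι P.ι)).symm_apply_apply z
  refine iso_of_relabel (P := P.prod Q) (Q := Q.prod P) (Equiv.prodComm Q.ι P.ι) (fun z => ?_) ?_
  · constructor
    · rintro ⟨p, hp, q, hq, rfl⟩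
      rw [relabel_segre_comm]
      exact mem_image2_of_mem hq hp
    · rintro ⟨q, hq, p, hp, h⟩
      rw [← hback z, ← h, relabel_segre_comm]
      exact mem_image2_of_mem hp hq
  · rintro _ ⟨p, hp, q, hq, rfl⟩
    rw [relabel_segre_comm, segre_mem_prod_Y, segre_mem_prod_Y]
    tauto

theorem prod_assoc (P Q R : VarPair) : Iso ((P.prod Q).prod R) (P.prod (Q.prod R)) := by
  refine iso_of_relabel (P := (P.prod Q).prod R) (Q := P.prod (Q.prod R))
    (Equiv.prodAssoc P.ι Q.ι R.ι).symm (fun z => ?_) ?_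
  · constructor
    · rintro ⟨_, ⟨p, hp, q, hq, rfl⟩, r, hr, rfl⟩
      rw [relabel_segre_assoc]
      exact mem_image2_of_mem hp (mem_image2_of_mem hq hr)
    · rintro ⟨p, hp, _, ⟨q, hq, r, hr, rfl⟩, h⟩
      rw [← relabel_segre_assoc] at h
      rw [← (relabel _).injective h]
      exact mem_image2_of_mem (mem_image2_of_mem hp hq) hr
  · rintro _ ⟨_, ⟨p, hp, q, hq, rfl⟩, r, hr, rfl⟩
    rw [relabel_segre_assoc, segre_mem_prod_Y, segre_mem_prod_Y, segre_mem_prod_Y,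
      segre_mem_prod_Y, segre_mem_prod_X, segre_mem_prod_X]
    tauto

theorem one_prod (P : VarPair) : Iso (one.prod P) P := by
  have hsurj : ∀ z : PSpace (Unit × P.ι), ∃ p q, segre p q = z := fun z =>
    ⟨PSpace.mk (fun _ => 1) (Function.ne_iff.2 ⟨(), one_ne_zero⟩),
      relabel (Equiv.punitProd P.ι).symm z,
      (relabel (Equiv.punitProd P.ι).symm).injective (relabel_segre_unit _ _)⟩
  refine iso_of_relabel (P := one.prod P) (Q := P) (Equiv.punitProd P.ι).symm (fun z => ?_) ?_
  · obtain ⟨p, q, rfl⟩ := hsurj z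
    rw [relabel_segre_unit, segre_mem_prod_X]
    simp [one]
  · rintro _ ⟨p, hp, q, hq, rfl⟩
    rw [relabel_segre_unit, segre_mem_prod_Y]
    simp [one]

end VarPair

/-! ### The Grothendieck ring of pairs -/

/-- Isomorphism classes of pairs. -/
def PairClass : Type 1 := Quotient VarPair.isoSetoid

/-- The isomorphism class of a pair. -/
def PairClass.mk (P : VarPair) : PairClass := Quotient.mk _ P

/-- The commutative monoid of isomorphism classes of pairs under the product of pairs. -/
instance : CommMonoid PairClass where
  mul := Quotient.map₂ VarPair.prod fun _ _ h _ _ h' => VarPair.prod_iso h h'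
  one := PairClass.mk VarPair.one
  mul_assoc := by
    rintro ⟨P⟩ ⟨Q⟩ ⟨R⟩
    exact Quotient.sound (VarPair.prod_assoc P Q R)
  mul_comm := by
    rintro ⟨P⟩ ⟨Q⟩
    exact Quotient.sound (VarPair.prod_comm P Q)
  one_mul := by
    rintro ⟨P⟩
    exact Quotient.sound (VarPair.one_prod P)
  mul_one := by
    rintro ⟨P⟩
    exact Quotient.sound ((VarPair.prod_comm P _).trans (VarPair.one_prod P))

/-- The relations `[(X, Y)] = [(Z, Y ∩ Z)] + [(X \ Z, Y ∩ (X \ Z))]` for Zariski closed `Z ⊆ X`,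
where `Z = X ∩ C` with `C` closed in the ambient projective space. -/
def scissorRelations : Set (MonoidAlgebra ℤ PairClass) :=
  {r | ∃ (P : VarPair) (C : Set (PSpace P.ι)) (hC : IsClosed C),
    r = MonoidAlgebra.of ℤ PairClass (PairClass.mk P)
      - (MonoidAlgebra.of ℤ PairClass (PairClass.mk (P.restrict C hC.isLocallyClosed))
        + MonoidAlgebra.of ℤ PairClass
            (PairClass.mk (P.restrict Cᶜ hC.isOpen_compl.isLocallyClosed)))}

/-- The Grothendieck ring of pairs: the free abelian group on the isomorphism classes of pairs, with
the multiplication induced by the product of pairs, modulo the scissor relations. (The product of a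
scissor relation with the class of a pair is again a scissor relation, so the additive subgroup
generated by these relations is already an ideal.) -/
abbrev K0Pairs : Type 1 := MonoidAlgebra ℤ PairClass ⧸ Ideal.span scissorRelations

/-- The class of a pair in the Grothendieck ring. -/
def cls (P : VarPair) : K0Pairs :=
  Ideal.Quotient.mk (Ideal.span scissorRelations)
    (MonoidAlgebra.of ℤ PairClass (PairClass.mk P))

/-- `P` is the disjoint union of (copies of) `P₁` and `P₂`: the ambient variety is covered by two
disjoint relatively closed subsets that cut out pairs isomorphic to `P₁` and `P₂`. -/
def IsDisjointUnion (P P₁ P₂ : VarPair) : Prop :=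
  ∃ (C₁ C₂ : Set (PSpace P.ι)) (h₁ : IsClosed C₁) (h₂ : IsClosed C₂),
    P.X ⊆ C₁ ∪ C₂ ∧ P.X ∩ C₁ ∩ C₂ = ∅ ∧
    (P.restrict C₁ h₁.isLocallyClosed).Iso P₁ ∧ (P.restrict C₂ h₂.isLocallyClosed).Iso P₂

/-! ### Configuration spaces of pairs -/

/-- The ordered configurations of `n` distinct points of `V`: the points of `Vⁿ` outside the big
diagonal. -/
def OrdConf (n : ℕ) (V : QPVariety) : Type := {x : Fin n → V.X // Function.Injective x}

/-- The embedding of `Vⁿ` minus the big diagonal into a projective space by the Segre map. -/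
def OrdConf.val {n : ℕ} {V : QPVariety} (x : OrdConf n V) : PSpace (Fin n → V.ι) :=
  segrePow fun i => (x.1 i : PSpace V.ι)

/-- The variety `V` is, by means of `π`, the quotient by the symmetric group of the space of ordered
configurations of `n` distinct points of `U`: the points of `V` are the orbits, and a map from `V`
to a quasi-projective variety is regular precisely when it comes from a regular map. -/
structure IsConfQuotient (n : ℕ) (U V : QPVariety) (π : OrdConf n U → V.X) : Prop where
  surjective : Function.Surjective π
  eq_iff : ∀ x y, π x = π y ↔ ∃ σ : Equiv.Perm (Fin n), y.1 = x.1 ∘ σ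
  regular_iff : ∀ (W : QPVariety) (f : V.X → W.X),
    IsRegular V.val (W.val ∘ f) ↔ IsRegular OrdConf.val (W.val ∘ f ∘ π)

/-- The pair `Q` is the `n`-th unordered configuration space `Λⁿ(P)` of the pair `P = (X, Y)`: its
ambient variety is the quotient `(Xⁿ \ Δ) / Sₙ`, and its subvariety consists of the unordered tuples
of which at least one point belongs to `Y`. -/
def IsConfigurationPair (n : ℕ) (P Q : VarPair) : Prop :=
  ∃ π : OrdConf n P.toQPVariety → Q.X, IsConfQuotient n P.toQPVariety Q.toQPVariety π ∧
    ∀ x, (π x : PSpace Q.ι) ∈ Q.Y ↔ ∃ i, (x.1 i : PSpace P.ι) ∈ P.Y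

/-- The series `f` is `1 + ∑_{n ≥ 1} [Λⁿ(P)] tⁿ`. -/
def IsConfigurationSeries (P : VarPair) (f : PowerSeries K0Pairs) : Prop :=
  PowerSeries.coeff 0 f = 1 ∧
    ∀ n : ℕ, 1 ≤ n → ∃ Q, IsConfigurationPair n P Q ∧ PowerSeries.coeff n f = cls Q

/-! ### Lambda structures -/

/-- A (pre-)`λ`-structure on a commutative ring `R`: series `λ_a(t) = 1 + a t + ⋯` for all `a` in
`R` such that `λ_{a+b}(t) = λ_a(t) λ_b(t)`. -/
structure IsLambdaStructure {R : Type*} [CommRing R] (lam : R → PowerSeries R) : Prop where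
  coeff_zero : ∀ a, PowerSeries.coeff 0 (lam a) = 1
  coeff_one : ∀ a, PowerSeries.coeff 1 (lam a) = a
  add : ∀ a b, lam (a + b) = lam a * lam b

end VarPairs

end

noncomputable section

namespace VarPairs

open MvPolynomial Set Topology

/-! ### Regular maps: locality, products and projections -/

section Basics

variable {T T' ι κ μ : Type}

/-! An unordered tuple of points `[w i]` is recorded by its Chow form `v ↦ ∏ i, v ⬝ᵥ w i`, up to a
scalar; finitely many `v` suffice as coordinates (`chowMap`). On the chart where a fixed linear form
`u` is nonzero at every point, the vectors are normalized by `u ⬝ᵥ w i = 1`. There polarization and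
the fundamental theorem on symmetric polynomials show that the sum over all permutations of a
polynomial in the Segre coordinates is a polynomial in the Chow coordinates
(`sum_perm_mem_symmAlg`). Now average with a form that is nonzero at a given tuple of distinct
points and zero at its other reorderings (`exists_averaged_forms`). It follows that the fibres of
the Chow map over such tuples are orbits, that closed sets stable under permutations have images
closed among these tuples, and that regular maps descend. The image of the Chow map is locally
closed, because the coordinates of the points are integral over the Chow coordinates and maximal
ideals lift along integral extensions (`exists_chow_eq_of_relations`). Together this makes
`confPair` the configuration space; its uniqueness is the universal property of a quotient. For a
closed `C`, sort the configurations by the number `k` of points in `C`. The stratum belonging to `k`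
is the product of the configuration spaces of the two parts (`prod_confPair_iso_restrict`); a tuple
meets `Y` when one of its parts does, which is exactly the subset in the product of pairs. Summing
over the strata, the series of a pair is the product of the series of the two parts
(`confSeries_eq_mul`). Hence the series extends to a homomorphism from the free abelian group on the
classes to the units of the power series ring. It kills the ideal of relations, since a class times
a scissor relation is again a scissor relation. Uniqueness holds because the classes of pairs
generate the ring additively. -/

theorem IsRegular.comp_right {j : T → PSpace ι} {f : T → PSpace κ} (hf : IsRegular j f)
    (g : T' → T) : IsRegular (j ∘ g) (f ∘ g) := fun t =>
  let ⟨d, F, U, hF, hU, ht, h⟩ := hf (g t)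
  ⟨d, F, U, hF, hU, ht, fun s => h (g s)⟩

/-- Near `t` the value is a function of the coordinates given by `j` alone. This later turns
regularity into injectivity and well-definedness. -/
theorem IsRegular.eq_of_eq {j : T → PSpace ι} {f : T → PSpace κ} (hf : IsRegular j f) {s t : T}
    (h : j s = j t) : f s = f t := by
  obtain ⟨d, F, U, -, -, ht, hFU⟩ := hf t
  obtain ⟨h1, h2⟩ := hFU t ht
  obtain ⟨h3, h4⟩ := hFU s (h ▸ ht)
  rw [h2, h4]
  congr 1
  rw [h]

theorem IsRegular.exists_isOpen_iff {j : T → PSpace ι} {f : T → PSpace κ} (hf : IsRegular j f)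
    {U : Set (PSpace κ)} (hU : IsOpen U) :
    ∃ V : Set (PSpace ι), IsOpen V ∧ ∀ s, j s ∈ V ↔ f s ∈ U := by
  refine ⟨⋃₀ {V | IsOpen V ∧ ∀ s, j s ∈ V → f s ∈ U}, isOpen_sUnion fun V hV => hV.1,
    fun s => ⟨?_, fun hs => ?_⟩⟩
  · rintro ⟨V, hV, hs⟩
    exact hV.2 s hs
  · obtain ⟨V, hV, hsV, h⟩ := hf.exists_preimage s hU hs
    exact ⟨V, ⟨hV, h⟩, hsV⟩

theorem IsRegular.of_local {j : T → PSpace ι} {f : T → PSpace κ}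
    (h : ∀ t, ∃ (g : T → PSpace κ) (U : Set (PSpace ι)), IsRegular j g ∧ IsOpen U ∧ j t ∈ U ∧
      ∀ s, j s ∈ U → f s = g s) : IsRegular j f := by
  intro t
  obtain ⟨g, U, hg, hU, ht, hfg⟩ := h t
  obtain ⟨d, F, V, hF, hV, htV, hFV⟩ := hg t
  exact ⟨d, F, U ∩ V, hF, hU.inter hV, ⟨ht, htV⟩, fun s hs => hfg s hs.1 ▸ hFV s hs.2⟩

theorem exists_mk_eq_of_smul {p : PSpace ι} {v : ι → ℂ} (hv : v ≠ 0) (hp : p = PSpace.mk v hv)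
    {d : ℕ} {F : κ → MvPolynomial ι ℂ} (hF : ∀ k, (F k).IsHomogeneous d) {q : PSpace κ}
    {w : κ → ℂ} (hw : w ≠ 0) (hq : q = PSpace.mk w hw) {a : ℂ} (ha : a ≠ 0)
    (h : ∀ k, eval v (F k) = a * w k) :
    ∃ h : (fun k => eval p.coords (F k)) ≠ 0, q = PSpace.mk _ h := by
  obtain ⟨b, hb, hc⟩ := PSpace.coords_mk v hv
  have key : (fun k => eval p.coords (F k)) = (b ^ d * a) • w := by
    funext k
    rw [hp, hc, eval_smul_of_isHomogeneous (hF k), h, Pi.smul_apply, smul_eq_mul, mul_assoc]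
  have hne : b ^ d * a ≠ 0 := mul_ne_zero (pow_ne_zero _ hb) ha
  refine ⟨by rw [key]; exact smul_ne_zero hne hw, ?_⟩
  rw [hq, PSpace.mk_eq_mk]
  exact ⟨(b ^ d * a)⁻¹, by rw [key, smul_smul, inv_mul_cancel₀ hne, one_smul]⟩

/-- Any homogeneous representatives `v`, `w` may replace the chosen vectors `coords`; the factor `a`
may vary with the point, since it cancels projectively. -/
theorem IsRegular.of_rep {j : T → PSpace ι} {f : T → PSpace κ} {v : T → ι → ℂ}
    (hv : ∀ t, v t ≠ 0) (hj : ∀ t, j t = PSpace.mk (v t) (hv t)) {w : T → κ → ℂ}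
    (hw : ∀ t, w t ≠ 0) (hf : ∀ t, f t = PSpace.mk (w t) (hw t))
    (h : ∀ t, ∃ (d : ℕ) (F : κ → MvPolynomial ι ℂ) (U : Set (PSpace ι)),
      (∀ k, (F k).IsHomogeneous d) ∧ IsOpen U ∧ j t ∈ U ∧
      ∀ s, j s ∈ U → ∃ a : ℂ, a ≠ 0 ∧ ∀ k, eval (v s) (F k) = a * w s k) : IsRegular j f := by
  intro t
  obtain ⟨d, F, U, hF, hU, ht, h⟩ := h t
  refine ⟨d, F, U, hF, hU, ht, fun s hs => ?_⟩
  obtain ⟨a, ha, hFa⟩ := h s hs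
  exact exists_mk_eq_of_smul (hv s) (hj s) hF (hw s) (hf s) ha hFa

theorem isRegular_const (j : T → PSpace ι) (q : PSpace κ) : IsRegular j fun _ => q :=
  IsRegular.of_rep (fun t => (j t).coords_ne_zero) (fun t => (j t).mk_coords.symm)
    (fun _ => q.coords_ne_zero) (fun _ => q.mk_coords.symm) fun _ =>
    ⟨0, fun k => C (q.coords k), univ, fun _ => isHomogeneous_C _ _, isOpen_univ, mem_univ _,
      fun _ _ => ⟨1, one_ne_zero, fun k => by simp⟩⟩

/-! ### Closed points, Segre maps and the diagonal. -/

theorem PSpace.eq_of_minors {p q : PSpace ι}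
    (h : ∀ a b, p.coords a * q.coords b = p.coords b * q.coords a) : p = q := by
  rw [← p.mk_coords, ← q.mk_coords, PSpace.mk_eq_mk]
  obtain ⟨b, hb⟩ := Function.ne_iff.1 q.coords_ne_zero
  refine ⟨p.coords b / q.coords b, ?_⟩
  ext a
  simp only [Pi.smul_apply, smul_eq_mul]
  rw [div_mul_eq_mul_div, ← h, mul_div_assoc, div_self hb, mul_one]

theorem isClosed_singleton_pspace (q : PSpace ι) : IsClosed ({q} : Set (PSpace ι)) := by
  have hh : ∀ a b, (X a * C (q.coords b) - X b * C (q.coords a) :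
      MvPolynomial ι ℂ).IsHomogeneous 1 := fun a b => by
    have := fun a b => (isHomogeneous_X ℂ a).mul (isHomogeneous_C ι (q.coords b))
    simpa using (this a b).sub (this b a)
  have heq : ({q} : Set (PSpace ι)) = ⋂ (a : ι) (b : ι),
      (nonvanishing (X a * C (q.coords b) - X b * C (q.coords a) : MvPolynomial ι ℂ))ᶜ := by
    ext p
    simp only [mem_singleton_iff, mem_iInter, mem_compl_iff, nonvanishing, mem_ofPred_eq, not_not,
      map_sub, map_mul, eval_X, eval_C, sub_eq_zero]
    constructor
    · rintro rfl a b
      ring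
    · exact PSpace.eq_of_minors
  rw [heq]
  exact isClosed_iInter fun a => isClosed_iInter fun b => (isOpen_nonvanishing (hh a b)).isClosed_compl

theorem isClosed_of_finite_pspace {S : Set (PSpace ι)} (hS : S.Finite) : IsClosed S := by
  rw [← biUnion_of_singleton S]
  exact hS.isClosed_biUnion fun q _ => isClosed_singleton_pspace q

theorem IsRegular.segre {j : T → PSpace ι} {f : T → PSpace κ} {g : T → PSpace μ}
    (hf : IsRegular j f) (hg : IsRegular j g) : IsRegular j fun t => segre (f t) (g t) := by
  intro t
  obtain ⟨d, F, U, hF, hU, ht, hFU⟩ := hf t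
  obtain ⟨e, G, V, hG, hV, htV, hGV⟩ := hg t
  refine ⟨d + e, fun x => F x.1 * G x.2, U ∩ V, fun x => (hF _).mul (hG _), hU.inter hV, ⟨ht, htV⟩,
    fun s hs => ?_⟩
  obtain ⟨h1, h2⟩ := hFU s hs.1
  obtain ⟨h3, h4⟩ := hGV s hs.2
  beta_reduce
  rw [h2, h4, segre_mk]
  simp only [map_mul]
  exact ⟨segre_aux h1 h3, trivial⟩

/-- The pure tensor with factors `w i`. -/
def pureTensor {n : ℕ} (w : Fin n → ι → ℂ) (m : Fin n → ι) : ℂ := ∏ i, w i (m i)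

theorem pureTensor_ne_zero {n : ℕ} {w : Fin n → ι → ℂ} (hw : ∀ i, w i ≠ 0) :
    pureTensor w ≠ 0 := by
  choose m hm using fun i => Function.ne_iff.1 (hw i)
  exact Function.ne_iff.2 ⟨m, Finset.prod_ne_zero_iff.2 fun i _ => hm i⟩

theorem segrePow_eq {n : ℕ} (p : Fin n → PSpace ι) : segrePow p =
    PSpace.mk (pureTensor fun i => (p i).coords)
      (pureTensor_ne_zero fun i => (p i).coords_ne_zero) := rfl

theorem pureTensor_smul {n : ℕ} (a : Fin n → ℂ) (w : Fin n → ι → ℂ) :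
    pureTensor (fun i => a i • w i) = (∏ i, a i) • pureTensor w := by
  ext m
  simp [pureTensor, Finset.prod_mul_distrib]

theorem segrePow_mk {n : ℕ} {w : Fin n → ι → ℂ} (hw : ∀ i, w i ≠ 0) :
    segrePow (fun i => PSpace.mk (w i) (hw i)) = PSpace.mk _ (pureTensor_ne_zero hw) := by
  choose a _ ha using fun i => PSpace.coords_mk (w i) (hw i)
  rw [segrePow_eq, PSpace.mk_eq_mk]
  exact ⟨∏ i, a i, by rw [← pureTensor_smul]; simp only [ha]⟩

theorem IsRegular.segrePow {n : ℕ} {j : T → PSpace ι} {f : Fin n → T → PSpace κ}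
    (hf : ∀ i, IsRegular j (f i)) : IsRegular j fun t => VarPairs.segrePow fun i => f i t := by
  intro t
  choose d F U hF hU ht hFU using fun i => hf i t
  refine ⟨∑ i, d i, fun m => ∏ i, F i (m i), ⋂ i, U i,
    fun m => IsHomogeneous.prod _ _ _ fun i _ => hF i _, isOpen_iInter_of_finite hU,
    mem_iInter.2 ht, fun s hs => ?_⟩
  choose h1 h2 using fun i => hFU i s (mem_iInter.1 hs i)
  beta_reduce
  simp only [h2, segrePow_mk h1, map_prod]
  exact ⟨pureTensor_ne_zero h1, rfl⟩

theorem pureTensor_update {n : ℕ} (w : Fin n → ι → ℂ) (m : Fin n → ι) (i : Fin n) (a : ι) :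
    pureTensor w (Function.update m i a) = (∏ l ∈ Finset.univ.erase i, w l (m l)) * w i a := by
  rw [pureTensor, ← Finset.prod_erase_mul _ _ (Finset.mem_univ i), Function.update_self]
  congr 1
  refine Finset.prod_congr rfl fun l hl => ?_
  rw [Function.update_of_ne (Finset.ne_of_mem_erase hl)]

/-- Fixing all indices except the `i`-th at values where the coordinates do not vanish leaves a
nonzero multiple of the coordinate vector of the `i`-th point. The same indices `m` serve wherever
the coordinate `X m` is nonzero. -/
theorem isRegular_segrePow_apply {n : ℕ} (i : Fin n) :
    IsRegular (VarPairs.segrePow : (Fin n → PSpace ι) → _) fun x => x i := by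
  refine IsRegular.of_rep (fun x => pureTensor_ne_zero fun l => (x l).coords_ne_zero)
    (fun x => rfl) (fun x => (x i).coords_ne_zero) (fun x => (x i).mk_coords.symm) fun t => ?_
  choose m hm using fun l => Function.ne_iff.1 (t l).coords_ne_zero
  have hX : (X m : MvPolynomial (Fin n → ι) ℂ).IsHomogeneous 1 := isHomogeneous_X _ _
  refine ⟨1, fun a => X (Function.update m i a), nonvanishing (X m), fun a => isHomogeneous_X _ _,
    isOpen_nonvanishing hX, ?_, fun s hs =>
      ⟨∏ l ∈ Finset.univ.erase i, (s l).coords (m l), ?_, fun a => ?_⟩⟩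
  · rw [segrePow_eq, mk_mem_nonvanishing hX, eval_X]
    exact Finset.prod_ne_zero_iff.2 fun l _ => hm l
  · rw [segrePow_eq, mk_mem_nonvanishing hX, eval_X] at hs
    exact Finset.prod_ne_zero_iff.2 fun l _ => Finset.prod_ne_zero_iff.1 hs l (Finset.mem_univ l)
  · rw [eval_X, pureTensor_update]

theorem segrePow_injective {n : ℕ} :
    Function.Injective (VarPairs.segrePow : (Fin n → PSpace ι) → _) :=
  fun _ _ h => funext fun i => (isRegular_segrePow_apply i).eq_of_eq h

/-- Two points agree exactly when the 2 × 2 minors of their coordinates vanish, and these are linear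
forms in the Segre coordinates. -/
theorem exists_isOpen_segre_ne :
    ∃ V : Set (PSpace (ι × ι)), IsOpen V ∧ ∀ p q, VarPairs.segre p q ∈ V ↔ p ≠ q := by
  have hh : ∀ a b, (X (a, b) - X (b, a) : MvPolynomial (ι × ι) ℂ).IsHomogeneous 1 := fun a b =>
    (isHomogeneous_X _ _).sub (isHomogeneous_X _ _)
  refine ⟨⋃ (a : ι) (b : ι), nonvanishing (X (a, b) - X (b, a) : MvPolynomial (ι × ι) ℂ),
    isOpen_iUnion fun a => isOpen_iUnion fun b => isOpen_nonvanishing (hh a b), fun p q => ?_⟩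
  simp only [mem_iUnion, segre_eq, mk_mem_nonvanishing (hh _ _), map_sub, eval_X, sub_ne_zero]
  constructor
  · rintro ⟨a, b, h⟩ rfl
    exact h (mul_comm _ _)
  · intro hpq
    by_contra! h
    exact hpq (PSpace.eq_of_minors h)

theorem exists_isOpen_segrePow_ne {n : ℕ} (i l : Fin n) :
    ∃ V : Set (PSpace (Fin n → ι)), IsOpen V ∧ ∀ x, VarPairs.segrePow x ∈ V ↔ x i ≠ x l := by
  obtain ⟨V, hV, h⟩ := exists_isOpen_segre_ne (ι := ι)
  obtain ⟨W, hW, h'⟩ :=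
    ((isRegular_segrePow_apply i).segre (isRegular_segrePow_apply l)).exists_isOpen_iff hV
  exact ⟨W, hW, fun x => (h' x).trans (h _ _)⟩

end Basics

/-! ### Symmetric functions of several vectors -/

section Multisymmetric

/-- Modulo `M` and after any linear functional, the sum is a complex polynomial in `s` vanishing
everywhere, so its coefficients are zero. This is the polarization device used repeatedly below. -/
theorem mem_of_forall_sum_pow_smul_mem {E : Type*} [AddCommGroup E] [Module ℂ E]
    (M : Submodule ℂ E) (N : ℕ) (a : ℕ → E)
    (h : ∀ s : ℂ, ∑ k ∈ Finset.range N, s ^ k • a k ∈ M) {k : ℕ} (hk : k < N) : a k ∈ M := by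
  rw [← Submodule.Quotient.mk_eq_zero]
  rw [← Module.forall_dual_apply_eq_zero_iff ℂ]
  intro f
  have hp : (∑ k ∈ Finset.range N, Polynomial.C (f (Submodule.Quotient.mk (a k))) *
      Polynomial.X ^ k : Polynomial ℂ) = 0 := by
    refine Polynomial.funext fun s => ?_
    have h1 := (Submodule.Quotient.mk_eq_zero M).2 (h s)
    rw [← M.mkQ_apply, map_sum] at h1
    have h2 := congrArg f h1
    rw [map_sum, map_zero] at h2
    rw [Polynomial.eval_finsetSum, Polynomial.eval_zero, ← h2]
    refine Finset.sum_congr rfl fun k _ => ?_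
    rw [Polynomial.eval_mul, Polynomial.eval_C, Polynomial.eval_pow, Polynomial.eval_X, mul_comm,
      map_smul, map_smul, smul_eq_mul, M.mkQ_apply]
  have := congrArg (fun p => Polynomial.coeff p k) hp
  simpa [Polynomial.finsetSum_coeff, Polynomial.coeff_C_mul, Polynomial.coeff_X_pow, hk] using this

variable {ι : Type} [Fintype ι]

/-- The linear form with coefficients `v`, as a polynomial. -/
def linForm (v : ι → ℂ) : MvPolynomial ι ℂ := ∑ j, C (v j) * X j

theorem eval_linForm (v w : ι → ℂ) : eval w (linForm v) = v ⬝ᵥ w := by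
  simp [linForm, dotProduct]

theorem linForm_add_smul (v w : ι → ℂ) (s : ℂ) :
    linForm (v + s • w) = linForm v + s • linForm w := by
  simp only [linForm, Finset.smul_sum, ← Finset.sum_add_distrib]
  refine Finset.sum_congr rfl fun j _ => ?_
  rw [Pi.add_apply, Pi.smul_apply, C_add, smul_eq_mul, C_mul, smul_eq_C_mul]
  ring

theorem linForm_single [DecidableEq ι] (i : ι) : linForm (Pi.single i 1) = X i := by
  simp [linForm, Pi.single_apply]

theorem isHomogeneous_linForm (v : ι → ℂ) : (linForm v).IsHomogeneous 1 :=
  IsHomogeneous.sum _ _ _ fun _ _ => isHomogeneous_C_mul_X _ _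

/-- Every polynomial is a linear combination of powers of linear forms. -/
theorem span_linForm_pow :
    Submodule.span ℂ (range fun x : (ι → ℂ) × ℕ => linForm x.1 ^ x.2) = ⊤ := by
  classical
  set W := Submodule.span ℂ (range fun x : (ι → ℂ) × ℕ => linForm x.1 ^ x.2) with hW
  have hgen : ∀ v e, linForm v ^ e ∈ W := fun v e => Submodule.subset_span ⟨(v, e), rfl⟩
  have hmul : ∀ v w : ι → ℂ, ∀ e, linForm v ^ e * linForm w ∈ W := by
    intro v w e
    -- The coefficient of `s` in `(linForm v + s • linForm w) ^ (e + 1)` is `e + 1` times the wanted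
    -- product; characteristic zero allows the division.
    have h := mem_of_forall_sum_pow_smul_mem W (e + 1 + 1)
      (fun k => linForm w ^ k * linForm v ^ (e + 1 - k) * ((e + 1).choose k : MvPolynomial ι ℂ))
      (fun s => by
        have h1 := hgen (v + s • w) (e + 1)
        rw [linForm_add_smul, add_comm, add_pow] at h1
        convert h1 using 2
        rw [smul_pow, smul_mul_assoc, smul_mul_assoc]) (k := 1) (by omega)
    have h2 := W.smul_mem ((e + 1 : ℂ)⁻¹) h
    convert h2 using 1
    have h3 : ((e + 1 : ℕ) : MvPolynomial ι ℂ) = C (e + 1 : ℂ) := by simp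
    rw [Nat.choose_one_right, h3, smul_eq_C_mul, mul_comm (_ * _) (C _), ← mul_assoc, ← C_mul,
      inv_mul_cancel₀ (by exact_mod_cast Nat.succ_ne_zero e)]
    simp [mul_comm]
  rw [eq_top_iff]
  rintro p -
  induction p using MvPolynomial.induction_on with
  | C a =>
    have := W.smul_mem a (hgen 0 0)
    rwa [pow_zero, smul_eq_C_mul, mul_one] at this
  | add p q hp hq => exact W.add_mem hp hq
  | mul_X p i hp =>
    induction hp using Submodule.span_induction with
    | mem x hx =>
      obtain ⟨⟨v, e⟩, rfl⟩ := hx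
      rw [← linForm_single]
      exact hmul _ _ _
    | zero => rw [zero_mul]; exact W.zero_mem
    | add x y _ _ hx hy => rw [add_mul]; exact W.add_mem hx hy
    | smul a x _ hx => rw [smul_mul_assoc]; exact W.smul_mem _ hx

/-- The product of the values of a linear form at `n` vectors. -/
def formProd {n : ℕ} (u : ι → ℂ) (w : Fin n → ι → ℂ) : ℂ := ∏ i, u ⬝ᵥ w i

/-- The tuples of vectors normalized by the linear form `u`. -/
abbrev Normalized (n : ℕ) (u : ι → ℂ) : Type := {w : Fin n → ι → ℂ // ∀ i, u ⬝ᵥ w i = 1}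

/-- The algebra of functions on normalized tuples generated by the products of the values of a
linear form. -/
def symmAlg (n : ℕ) (u : ι → ℂ) : Subalgebra ℂ (Normalized n u → ℂ) :=
  Algebra.adjoin ℂ (range fun v w => formProd v w.1)

variable {n : ℕ} (u : ι → ℂ)

/-- On normalized tuples the product of the values of `u + s • v` is `∏ i, (1 + s * (v ⬝ᵥ w i))`;
its coefficient at `s ^ k` is the elementary symmetric function. -/
theorem esymm_mem_symmAlg (v : ι → ℂ) (k : ℕ) :
    (fun w : Normalized n u => ∑ t ∈ Finset.powersetCard k Finset.univ, ∏ i ∈ t, v ⬝ᵥ w.1 i) ∈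
      symmAlg n u := by
  by_cases hk : k < n + 1
  · refine mem_of_forall_sum_pow_smul_mem (symmAlg n u).toSubmodule (n + 1)
      (fun k w => ∑ t ∈ Finset.powersetCard k Finset.univ, ∏ i ∈ t, v ⬝ᵥ w.1 i) (fun s => ?_) hk
    have h : (fun w : Normalized n u => formProd (u + s • v) w.1) ∈ symmAlg n u :=
      Algebra.subset_adjoin ⟨_, rfl⟩
    rw [Subalgebra.mem_toSubmodule]
    convert h using 1
    funext w
    rw [formProd]
    simp only [add_dotProduct, smul_dotProduct, w.2, Finset.prod_one_add, Finset.sum_powerset,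
      Finset.card_univ, Fintype.card_fin, Finset.sum_apply, Pi.smul_apply, smul_eq_mul,
      Finset.mul_sum, Finset.prod_mul_distrib, Finset.prod_const]
    refine Finset.sum_congr rfl fun k _ => Finset.sum_congr rfl fun t ht => ?_
    rw [(Finset.mem_powersetCard.1 ht).2]
  · rw [Finset.powersetCard_eq_empty.2 (by simpa using hk)]
    exact (symmAlg n u).zero_mem

theorem aeval_mem_subalgebra {σ A : Type*} [CommRing A] [Algebra ℂ A] (S : Subalgebra ℂ A)
    {a : σ → A} (ha : ∀ i, a i ∈ S) (p : MvPolynomial σ ℂ) : aeval a p ∈ S := by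
  induction p using MvPolynomial.induction_on with
  | C r => rw [aeval_C]; exact S.algebraMap_mem r
  | add p q hp hq => rw [map_add]; exact S.add_mem hp hq
  | mul_X p i hp => rw [map_mul, aeval_X]; exact S.mul_mem hp (ha i)

/-- By linearity `φ` may be a power of a linear form. The sum is then a power sum of the values of
that form, hence a polynomial in their elementary symmetric functions. -/
theorem sum_eval_mem_symmAlg (φ : MvPolynomial ι ℂ) :
    (fun w : Normalized n u => ∑ i, eval (w.1 i) φ) ∈ symmAlg n u := by
  have hφ : φ ∈ Submodule.span ℂ (range fun x : (ι → ℂ) × ℕ => linForm x.1 ^ x.2) := by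
    rw [span_linForm_pow]; trivial
  induction hφ using Submodule.span_induction with
  | mem x hx =>
    obtain ⟨⟨v, e⟩, rfl⟩ := hx
    obtain ⟨Q, hQ⟩ := esymmAlgHom_surjective (σ := Fin n) ℂ (n := n) (by simp)
      ⟨psum (Fin n) ℂ e, psum_isSymmetric _ _ _⟩
    have h1 := congrArg Subtype.val hQ
    rw [esymmAlgHom_apply] at h1
    have h2 := congrArg (aeval fun (i : Fin n) (w : Normalized n u) => v ⬝ᵥ w.1 i) h1
    rw [← AlgHom.comp_apply, comp_aeval] at h2
    have h3 : (fun w : Normalized n u => ∑ i, eval (w.1 i) (linForm v ^ e)) =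
        aeval (fun (i : Fin n) (w : Normalized n u) => v ⬝ᵥ w.1 i) (psum (Fin n) ℂ e) := by
      funext w
      simp [psum, eval_linForm]
    rw [h3, ← h2]
    refine aeval_mem_subalgebra _ (fun i => ?_) Q
    convert esymm_mem_symmAlg u v (i + 1) using 1
    funext w
    simp [esymm]
  | zero =>
    simp only [map_zero, Finset.sum_const_zero]
    exact (symmAlg n u).zero_mem
  | add x y _ _ hx hy =>
    simp only [map_add, Finset.sum_add_distrib]
    exact (symmAlg n u).add_mem hx hy
  | smul a x _ hx =>
    simp only [smul_eval, ← Finset.mul_sum]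
    exact (symmAlg n u).smul_mem hx a

/-- Induction on the number of slots. Multiplying by a sum over single vectors lets the new index
run over everything; its collisions with an old index are removed by sums in which `φ 0` has been
absorbed into the factor of that old slot. -/
theorem sum_embedding_mem_symmAlg (k : ℕ) : ∀ φ : Fin k → MvPolynomial ι ℂ,
    (fun w : Normalized n u => ∑ τ : Fin k ↪ Fin n, ∏ j, eval (w.1 (τ j)) (φ j)) ∈
      symmAlg n u := by
  classical
  induction k with
  | zero =>
    intro φ
    simp only [Finset.univ_eq_empty, Finset.prod_empty, Finset.univ_unique, Finset.sum_const,
      Finset.card_singleton, one_smul]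
    exact (symmAlg n u).one_mem
  | succ k ih =>
    intro φ
    have h1 := (symmAlg n u).mul_mem (ih (φ ∘ Fin.succ)) (sum_eval_mem_symmAlg u (φ 0))
    have h2 := (symmAlg n u).sum_mem (t := Finset.univ) fun j _ =>
      ih (Function.update (φ ∘ Fin.succ) j (φ j.succ * φ 0))
    convert (symmAlg n u).sub_mem h1 h2 using 1
    funext w
    simp only [Pi.mul_apply, Pi.sub_apply, Finset.sum_apply]
    -- An embedding of `k + 1` slots is an embedding `τ` of the last `k` of them together with a
    -- value outside its range.
    rw [Finset.sum_comm (s := Finset.univ (α := Fin k)), Finset.sum_mul, ← Finset.sum_sub_distrib,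
      ← (Equiv.embeddingFinSucc k (Fin n)).symm.sum_comp, Fintype.sum_sigma]
    refine Finset.sum_congr rfl fun τ _ => ?_
    have h3 : ∀ j, ∏ l, eval (w.1 (τ l)) (Function.update (φ ∘ Fin.succ) j (φ j.succ * φ 0) l) =
        (∏ l, eval (w.1 (τ l)) (φ l.succ)) * eval (w.1 (τ j)) (φ 0) := by
      intro j
      rw [← Finset.prod_erase_mul _ _ (Finset.mem_univ j),
        ← Finset.prod_erase_mul Finset.univ (fun l => eval (w.1 (τ l)) (φ l.succ))
          (Finset.mem_univ j), Function.update_self, map_mul, mul_assoc]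
      congr 1
      refine Finset.prod_congr rfl fun l hl => ?_
      rw [Function.update_of_ne (Finset.ne_of_mem_erase hl)]
      rfl
    simp only [h3, Equiv.coe_embeddingFinSucc_symm, Fin.prod_univ_succ, Fin.cons_zero,
      Fin.cons_succ, Function.comp_apply]
    rw [← Finset.mul_sum, ← mul_sub, ← Finset.sum_mul, mul_comm]
    congr 1
    rw [eq_sub_iff_add_eq, ← Finset.sum_map Finset.univ τ fun i => eval (w.1 i) (φ 0),
      ← Finset.sum_subtype (Finset.univ.filter fun i => i ∉ Set.range τ) (by simp)
        fun i => eval (w.1 i) (φ 0)]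
    rw [← Finset.sum_filter_not_add_sum_filter Finset.univ (fun i => i ∈ Set.range τ)]
    congr 1
    refine Finset.sum_congr ?_ fun _ _ => rfl
    ext i
    simp

/-- At a pure tensor a monomial splits into one polynomial factor per vector, and permutations are
the embeddings of `Fin n` into itself, so the sums over embeddings with `k = n` apply. -/
theorem sum_perm_mem_symmAlg (G : MvPolynomial (Fin n → ι) ℂ) :
    (fun w : Normalized n u => ∑ σ : Equiv.Perm (Fin n), eval (pureTensor (w.1 ∘ σ)) G) ∈
      symmAlg n u := by
  induction G using MvPolynomial.induction_on' with
  | add p q hp hq =>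
    simp only [map_add, Finset.sum_add_distrib]
    exact (symmAlg n u).add_mem hp hq
  | monomial a c =>
    have h := (symmAlg n u).smul_mem (sum_embedding_mem_symmAlg u n
      fun i => a.prod fun m e => (X (m i) : MvPolynomial ι ℂ) ^ e) c
    convert h using 1
    funext w
    rw [Pi.smul_apply, smul_eq_mul, Finset.mul_sum,
      ← (Equiv.embeddingEquivOfFinite (Fin n)).symm.sum_comp]
    refine Finset.sum_congr rfl fun σ _ => ?_
    rw [eval_monomial]
    congr 1
    simp only [Finsupp.prod, map_prod, map_pow, eval_X]
    rw [Finset.prod_comm]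
    refine Finset.prod_congr rfl fun m _ => ?_
    rw [pureTensor, Finset.prod_pow]
    rfl

end Multisymmetric

/-! ### Chow coordinates of unordered tuples -/

section Chow

variable {ι : Type} [Fintype ι] {n : ℕ}

/-- Finitely many hyperplanes do not cover a complex vector space. The form `u` provides a chart
around a given tuple. -/
theorem exists_dotProduct_ne_zero {α : Type*} [Finite α] {w : α → ι → ℂ} (hw : ∀ i, w i ≠ 0) :
    ∃ u : ι → ℂ, ∀ i, u ⬝ᵥ w i ≠ 0 := by
  classical
  obtain ⟨f, hf⟩ := Module.exists_dual_forall_apply_ne_zero (K := ℂ) w hw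
  refine ⟨fun j => f (Pi.single j 1), fun i => ?_⟩
  convert hf i using 1
  rw [LinearMap.pi_apply_eq_sum_univ f (w i)]
  simp only [dotProduct, smul_eq_mul, mul_comm]
  refine Finset.sum_congr rfl fun j _ => ?_
  congr 2
  ext k
  simp [Pi.single_apply, eq_comm]

theorem formProd_eq_sum (u : ι → ℂ) (w : Fin n → ι → ℂ) :
    formProd u w = ∑ m : Fin n → ι, (∏ i, u (m i)) * pureTensor w m := by
  classical
  simp only [formProd, dotProduct, Finset.prod_univ_sum, pureTensor, ← Finset.prod_mul_distrib,
    Fintype.piFinset_univ]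

variable (ι n) in
-- By multilinearity all these products lie in the span of the finitely many functions `w ↦
-- pureTensor w m`, so finitely many of them span the others. They need not be independent, so the
-- coefficients `c` involve a choice.
theorem exists_finset_formProd : ∃ E : Finset (ι → ℂ), ∀ u : ι → ℂ, ∃ c : E → ℂ,
    ∀ w : Fin n → ι → ℂ, formProd u w = ∑ e, c e * formProd e.1 w := by
  classical
  set S : Set ((Fin n → ι → ℂ) → ℂ) := range formProd with hS
  have hle : Submodule.span ℂ S ≤
      Submodule.span ℂ (range fun (m : Fin n → ι) (w : Fin n → ι → ℂ) => pureTensor w m) := by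
    rw [Submodule.span_le]
    rintro _ ⟨u, rfl⟩
    have : formProd u = ∑ m : Fin n → ι, (∏ i, u (m i)) • fun w => pureTensor w m := by
      funext w
      simp [formProd_eq_sum]
    rw [this]
    exact Submodule.sum_mem _ fun m _ => Submodule.smul_mem _ _ (Submodule.subset_span ⟨m, rfl⟩)
  have hfg : (Submodule.span ℂ S).FG := by
    have : FiniteDimensional ℂ (Submodule.span ℂ
        (range fun (m : Fin n → ι) (w : Fin n → ι → ℂ) => pureTensor w m)) :=
      FiniteDimensional.span_of_finite ℂ (finite_range _)
    have := Submodule.finiteDimensional_of_le hle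
    exact Module.Finite.iff_fg.1 this
  obtain ⟨s, hs, hspan⟩ := (Submodule.fg_span_iff_fg_span_finset_subset S).1 hfg
  rw [hS, ← image_univ, Finset.subset_set_image_iff] at hs
  obtain ⟨E, -, rfl⟩ := hs
  refine ⟨E, fun u => ?_⟩
  have hu : formProd u ∈ Submodule.span ℂ S := Submodule.subset_span ⟨u, rfl⟩
  have hE : ((Finset.image formProd E : Finset ((Fin n → ι → ℂ) → ℂ)) : Set _) =
      range fun e : E => formProd (n := n) e.1 := by
    ext f
    simp
  rw [hspan, hE, Submodule.mem_span_range_iff_exists_fun] at hu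
  obtain ⟨c, hc⟩ := hu
  refine ⟨c, fun w => ?_⟩
  rw [← hc]
  simp

variable (ι n) in
/-- The index set of the Chow coordinates: finitely many linear forms whose products span. -/
abbrev ChowIndex : Type := (exists_finset_formProd ι n).choose

/-- The Chow coordinates of a tuple of vectors. -/
def chow (w : Fin n → ι → ℂ) (e : ChowIndex ι n) : ℂ := formProd e.1 w

/-- The linear form in the Chow coordinates whose value is the product of the values of `u`. -/
def chowForm (n : ℕ) (u : ι → ℂ) : MvPolynomial (ChowIndex ι n) ℂ :=
  linForm ((exists_finset_formProd ι n).choose_spec u).choose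

theorem eval_chowForm (u : ι → ℂ) (w : Fin n → ι → ℂ) :
    eval (chow w) (chowForm n u) = formProd u w := by
  rw [chowForm, eval_linForm, ((exists_finset_formProd ι n).choose_spec u).choose_spec w]
  rfl

theorem isHomogeneous_chowForm (u : ι → ℂ) : (chowForm n u).IsHomogeneous 1 :=
  isHomogeneous_linForm _

theorem formProd_ne_zero {u : ι → ℂ} {w : Fin n → ι → ℂ} (h : ∀ i, u ⬝ᵥ w i ≠ 0) :
    formProd u w ≠ 0 := Finset.prod_ne_zero_iff.2 fun i _ => h i

theorem formProd_smul (u : ι → ℂ) (a : Fin n → ℂ) (w : Fin n → ι → ℂ) :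
    formProd u (fun i => a i • w i) = (∏ i, a i) * formProd u w := by
  simp [formProd, Finset.prod_mul_distrib]

theorem chow_smul (a : Fin n → ℂ) (w : Fin n → ι → ℂ) :
    chow (fun i => a i • w i) = (∏ i, a i) • chow w := funext fun e => formProd_smul e.1 a w

theorem chow_comp_perm (w : Fin n → ι → ℂ) (σ : Equiv.Perm (Fin n)) : chow (w ∘ σ) = chow w :=
  funext fun e => Equiv.prod_comp σ fun i => e.1 ⬝ᵥ w i

theorem chow_ne_zero {w : Fin n → ι → ℂ} (hw : ∀ i, w i ≠ 0) : chow w ≠ 0 := by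
  obtain ⟨u, hu⟩ := exists_dotProduct_ne_zero hw
  intro h
  refine formProd_ne_zero hu ?_
  rw [← eval_chowForm, h, chowForm, eval_linForm, dotProduct_zero]

theorem exists_eval_chow_of_mem_symmAlg {u : ι → ℂ} {f : Normalized n u → ℂ}
    (hf : f ∈ symmAlg n u) :
    ∃ Q : MvPolynomial (ChowIndex ι n) ℂ, ∀ w, f w = eval (chow w.1) Q := by
  induction hf using Algebra.adjoin_induction with
  | mem x hx =>
    obtain ⟨v, rfl⟩ := hx
    exact ⟨chowForm n v, fun w => (eval_chowForm v w.1).symm⟩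
  | algebraMap r => exact ⟨C r, fun w => by simp⟩
  | add x y _ _ hx hy =>
    obtain ⟨P, hP⟩ := hx
    obtain ⟨Q, hQ⟩ := hy
    exact ⟨P + Q, fun w => by simp [hP, hQ]⟩
  | mul x y _ _ hx hy =>
    obtain ⟨P, hP⟩ := hx
    obtain ⟨Q, hQ⟩ := hy
    exact ⟨P * Q, fun w => by simp [hP, hQ]⟩

/-- Each homogeneous component is raised to degree `M` by a power of `L`. Allowing any large `M`
gives several polynomials a common degree, as the components of a regular map require. -/
theorem exists_homogenization {σ : Type} {L : MvPolynomial σ ℂ} (hL : L.IsHomogeneous 1)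
    (Q : MvPolynomial σ ℂ) {M : ℕ} (hM : Q.totalDegree ≤ M) :
    ∃ Q' : MvPolynomial σ ℂ, Q'.IsHomogeneous M ∧ ∀ z, eval z L ≠ 0 →
      eval z Q' = eval z L ^ M * eval ((eval z L)⁻¹ • z) Q := by
  refine ⟨∑ e ∈ Finset.range (M + 1), homogeneousComponent e Q * L ^ (M - e),
    IsHomogeneous.sum _ _ _ fun e he => ?_, fun z hz => ?_⟩
  · have := (homogeneousComponent_isHomogeneous e Q).mul (hL.pow (M - e))
    rwa [one_mul, Nat.add_sub_cancel' (Finset.mem_range_succ_iff.1 he)] at this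
  · have hQ : Q = ∑ e ∈ Finset.range (M + 1), homogeneousComponent e Q := by
      conv_lhs => rw [← sum_homogeneousComponent Q]
      refine Finset.sum_subset (Finset.range_mono (by omega)) fun e _ he => ?_
      exact homogeneousComponent_eq_zero _ _ (by simpa using he)
    conv_rhs => rw [hQ]
    rw [map_sum, map_sum, Finset.mul_sum]
    refine Finset.sum_congr rfl fun e he => ?_
    rw [eval_smul_of_isHomogeneous (homogeneousComponent_isHomogeneous e Q), map_mul, map_pow,
      inv_pow, ← mul_assoc, mul_comm,
      pow_sub₀ _ hz (Finset.mem_range_succ_iff.1 he)]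

theorem dotProduct_normalize {u : ι → ℂ} {w : Fin n → ι → ℂ} (h : ∀ i, u ⬝ᵥ w i ≠ 0) (i : Fin n) :
    u ⬝ᵥ ((u ⬝ᵥ w i)⁻¹ • w i) = 1 := by
  rw [dotProduct_smul, smul_eq_mul, inv_mul_cancel₀ (h i)]

/-- Symmetrized forms in the Segre coordinates are forms in the Chow coordinates, up to powers of
the product of the values of a linear form. -/
theorem exists_symmetrization {κ : Type} [Finite κ] (u : ι → ℂ) {d : ℕ}
    {G : κ → MvPolynomial (Fin n → ι) ℂ} (hG : ∀ k, (G k).IsHomogeneous d) :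
    ∃ (M r : ℕ) (Q : κ → MvPolynomial (ChowIndex ι n) ℂ), (∀ k, (Q k).IsHomogeneous M) ∧
      ∀ w k, eval (chow w) (Q k) = formProd u w ^ r *
        ∑ σ : Equiv.Perm (Fin n), eval (pureTensor (w ∘ σ)) (G k) := by
  cases nonempty_fintype κ
  choose Q₀ hQ₀ using fun k => exists_eval_chow_of_mem_symmAlg (sum_perm_mem_symmAlg u (G k))
  set M := Finset.univ.sup fun k => (Q₀ k).totalDegree with hM
  choose Q hQ hQz using fun k => exists_homogenization (isHomogeneous_chowForm (n := n) u) (Q₀ k)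
    (M := M) (Finset.le_sup (f := fun k => (Q₀ k).totalDegree) (Finset.mem_univ k))
  -- Normalizing the tuple divides forms of degree `d` by `formProd u w ^ d`, which `d` of the
  -- factors `chowForm n u` cancel. The extra factor makes both sides vanish when `formProd u w =
  -- 0`, where the tuple cannot be normalized.
  refine ⟨1 * (d + 1) + M, M + 1, fun k => chowForm n u ^ (d + 1) * Q k,
    fun k => ((isHomogeneous_chowForm u).pow _).mul (hQ k), fun w k => ?_⟩
  by_cases h0 : formProd u w = 0
  · rw [map_mul, map_pow, eval_chowForm, h0, pow_succ, pow_succ]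
    ring
  have h : ∀ i, u ⬝ᵥ w i ≠ 0 := fun i => Finset.prod_ne_zero_iff.1 h0 i (Finset.mem_univ i)
  have h1 := hQ₀ k ⟨fun i => (u ⬝ᵥ w i)⁻¹ • w i, dotProduct_normalize h⟩
  have h2 : ∀ σ : Equiv.Perm (Fin n), eval (pureTensor ((fun i => (u ⬝ᵥ w i)⁻¹ • w i) ∘ σ)) (G k) =
      (formProd u w)⁻¹ ^ d * eval (pureTensor (w ∘ σ)) (G k) := by
    intro σ
    rw [← eval_smul_of_isHomogeneous (hG k)]
    congr 1
    have := pureTensor_smul (fun i => (u ⬝ᵥ w (σ i))⁻¹) (w ∘ σ)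
    rw [Equiv.prod_comp σ fun i => (u ⬝ᵥ w i)⁻¹, Finset.prod_inv_distrib] at this
    rw [formProd, ← this]
    rfl
  simp only [h2, chow_smul, Finset.prod_inv_distrib] at h1
  rw [map_mul, map_pow, hQz k _ (by rwa [eval_chowForm]), eval_chowForm]
  change _ = eval ((formProd u w)⁻¹ • _) _ at h1
  rw [← h1, ← Finset.mul_sum, inv_pow]
  field_simp
  ring

/-! ### Integrality over the Chow coordinates and the image of the Chow map. -/

variable (n) in
/-- Evaluation of polynomials in the Chow coordinates at normalized tuples. -/
def chowHom (u : ι → ℂ) : MvPolynomial (ChowIndex ι n) ℂ →+* (Normalized n u → ℂ) :=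
  RingHom.pi fun w => eval (chow w.1)

theorem chowHom_apply (u : ι → ℂ) (Q : MvPolynomial (ChowIndex ι n) ℂ) (w : Normalized n u) :
    chowHom n u Q w = eval (chow w.1) Q := by
  rw [chowHom, RingHom.pi_apply]

/-- The `j`-th coordinates of the vectors are the roots of the monic `P`. Since `u` takes the value
1, the value of `P` at a scalar `s` is the product of the values of `s • u - Pi.single j 1`; hence
the coefficients of `P` are polynomials in the Chow coordinates. -/
theorem isIntegralElem_coord (u : ι → ℂ) (i : Fin n) (j : ι) :
    (chowHom n u).IsIntegralElem fun w : Normalized n u => w.1 i j := by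
  classical
  have hrange : ∀ f ∈ symmAlg n u, f ∈ range (chowHom n u) := by
    intro f hf
    obtain ⟨Q, hQ⟩ := exists_eval_chow_of_mem_symmAlg hf
    refine ⟨Q, funext fun w => ?_⟩
    rw [hQ w, chowHom_apply]
  set P : Polynomial (Normalized n u → ℂ) :=
    ∏ l, (Polynomial.X - Polynomial.C fun w => w.1 l j) with hP
  have hmonic : P.Monic := Polynomial.monic_prod_of_monic _ _ fun l _ => Polynomial.monic_X_sub_C _
  have hroot : P.eval (fun w => w.1 i j) = 0 := by
    rw [hP, Polynomial.eval_prod]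
    exact Finset.prod_eq_zero (Finset.mem_univ i) (by simp)
  have hcoeff : ∀ k, P.coeff k ∈ symmAlg n u := by
    intro k
    by_cases hk : k < P.natDegree + 1
    · refine mem_of_forall_sum_pow_smul_mem (symmAlg n u).toSubmodule _ _ (fun s => ?_) hk
      have h : (fun w : Normalized n u => formProd (s • u - Pi.single j 1) w.1) ∈ symmAlg n u :=
        Algebra.subset_adjoin ⟨_, rfl⟩
      have h1 : P.eval (algebraMap ℂ _ s) =
          fun w : Normalized n u => formProd (s • u - Pi.single j 1) w.1 := by
        funext w
        rw [hP, Polynomial.eval_prod, Finset.prod_apply, formProd]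
        simp [sub_dotProduct, w.2]
      rw [← h1, Polynomial.eval_eq_sum_range] at h
      rw [Subalgebra.mem_toSubmodule]
      convert h using 2
      rw [← map_pow, mul_comm, Algebra.smul_def]
    · rw [Polynomial.coeff_eq_zero_of_natDegree_lt (by omega)]
      exact (symmAlg n u).zero_mem
  have hlift : P ∈ Polynomial.lifts (chowHom n u) :=
    (Polynomial.lifts_iff_coeff_lifts P).2 fun k => hrange _ (hcoeff k)
  obtain ⟨q, hq, -, hqm⟩ := Polynomial.lifts_and_natDegree_eq_and_monic hlift hmonic
  exact ⟨q, hqm, by rw [← Polynomial.eval_map, hq, hroot]⟩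

/-- A point at which all the relations between the Chow coordinates of normalized tuples hold is
the point of a normalized tuple. -/
theorem exists_chow_eq_of_relations (u : ι → ℂ) (z : ChowIndex ι n → ℂ)
    (hz : ∀ Q, (∀ w : Normalized n u, eval (chow w.1) Q = 0) → eval z Q = 0) :
    ∃ w : Normalized n u, chow w.1 = z := by
  let : Algebra (MvPolynomial (ChowIndex ι n) ℂ) (Normalized n u → ℂ) := (chowHom n u).toAlgebra
  set B := integralClosure (MvPolynomial (ChowIndex ι n) ℂ) (Normalized n u → ℂ) with hB
  set m : Ideal (MvPolynomial (ChowIndex ι n) ℂ) := RingHom.ker (eval z) with hm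
  have hsurj : Function.Surjective (eval z) := fun c => ⟨C c, eval_C c⟩
  have : m.IsMaximal := RingHom.ker_isMaximal_of_surjective _ hsurj
  have hval : ∀ Q, ((algebraMap _ B Q : B) : Normalized n u → ℂ) = chowHom n u Q :=
    fun Q => rfl
  -- The structure map to `B` need not be injective, so lying over requires its kernel to be
  -- contained in `m`; this is what the relations at `z` say.
  have hker : RingHom.ker (algebraMap (MvPolynomial (ChowIndex ι n) ℂ) B) ≤ m := by
    intro Q hQ
    refine hz Q fun w => ?_
    rw [← chowHom_apply, ← hval, RingHom.mem_ker.1 hQ]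
    rfl
  obtain ⟨q, hq, hcomap⟩ := Ideal.exists_ideal_over_maximal_of_isIntegral m hker
  let : Field (B ⧸ q) := Ideal.Quotient.field q
  let η : MvPolynomial (ChowIndex ι n) ℂ →+* B ⧸ q := (Ideal.Quotient.mk q).comp (algebraMap _ B)
  let : Algebra ℂ (B ⧸ q) := (η.comp C).toAlgebra
  have hη : ∀ Q, η Q = algebraMap ℂ (B ⧸ q) (eval z Q) := by
    intro Q
    change Ideal.Quotient.mk q _ = Ideal.Quotient.mk q _
    rw [Ideal.Quotient.eq, ← map_sub, ← Ideal.mem_comap, hcomap, hm, RingHom.mem_ker]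
    simp
  -- The residue field is integral over `ℂ` and therefore equal to it. This gives a homomorphism `χ`
  -- from `B` to `ℂ` above evaluation at `z`, and its values at the coordinate functions are the
  -- vectors sought.
  have : Algebra.IsIntegral ℂ (B ⧸ q) := by
    refine ⟨fun x => ?_⟩
    obtain ⟨b, rfl⟩ := Ideal.Quotient.mk_surjective x
    obtain ⟨p, hp, hpb⟩ := (Algebra.IsIntegral.isIntegral b :
      IsIntegral (MvPolynomial (ChowIndex ι n) ℂ) b)
    refine ⟨p.map (eval z), hp.map _, ?_⟩
    rw [Polynomial.eval₂_map]
    have : (algebraMap ℂ (B ⧸ q)).comp (eval z) = η := RingHom.ext fun Q => (hη Q).symm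
    rw [this, ← Polynomial.hom_eval₂, hpb, map_zero]
  let ε := RingEquiv.ofBijective (algebraMap ℂ (B ⧸ q))
    IsAlgClosed.algebraMap_bijective_of_isIntegral
  let χ : B →+* ℂ := ε.symm.toRingHom.comp (Ideal.Quotient.mk q)
  have hχ : ∀ Q, χ (algebraMap _ B Q) = eval z Q := by
    intro Q
    change ε.symm (η Q) = _
    rw [hη]
    exact ε.symm_apply_apply _
  let x : Fin n → ι → B := fun i j => ⟨fun w => w.1 i j, isIntegralElem_coord u i j⟩
  have hx : ∀ (v : ι → ℂ) (i : Fin n), v ⬝ᵥ (fun j => χ (x i j)) =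
      χ (∑ j, algebraMap (MvPolynomial (ChowIndex ι n) ℂ) B (C (v j)) * x i j) := by
    intro v i
    simp only [map_sum, map_mul, hχ, eval_C, dotProduct]
  have hsum : ∀ (v : ι → ℂ) (i : Fin n),
      ((∑ j, algebraMap (MvPolynomial (ChowIndex ι n) ℂ) B (C (v j)) * x i j : B) : Normalized n u → ℂ) =
        fun w => v ⬝ᵥ w.1 i := by
    intro v i
    funext w
    rw [AddSubmonoidClass.coe_finsetSum, Finset.sum_apply, dotProduct]
    refine Finset.sum_congr rfl fun j _ => ?_
    rw [MulMemClass.coe_mul, hval, Pi.mul_apply, chowHom_apply, eval_C]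
  refine ⟨⟨fun i j => χ (x i j), fun i => ?_⟩, funext fun e => ?_⟩
  · rw [hx]
    have : ∑ j, algebraMap (MvPolynomial (ChowIndex ι n) ℂ) B (C (u j)) * x i j = 1 := by
      apply Subtype.ext
      rw [hsum]
      exact funext fun w => w.2 i
    rw [this, map_one]
  · change ∏ i, e.1 ⬝ᵥ (fun j => χ (x i j)) = _
    simp only [hx]
    rw [← map_prod]
    have : ∏ i, ∑ j, algebraMap (MvPolynomial (ChowIndex ι n) ℂ) B (C (e.1 j)) * x i j =
        algebraMap (MvPolynomial (ChowIndex ι n) ℂ) B (X e) := by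
      apply Subtype.ext
      rw [hval, SubmonoidClass.coe_finsetProd]
      simp only [hsum]
      funext w
      rw [Finset.prod_apply, chowHom_apply, eval_X]
      rfl
    rw [this, hχ, eval_X]

/-- A relation violated at the rescaled `z` is homogenized with `chowForm n u`. One more factor
`chowForm n u` makes the form vanish also at tuples where `u` has a zero, which normalized tuples do
not see. -/
theorem exists_form_vanishing_on_chow (u : ι → ℂ) {z : ChowIndex ι n → ℂ}
    (hz : eval z (chowForm n u) ≠ 0)
    (h : ∀ w : Normalized n u, chow w.1 ≠ (eval z (chowForm n u))⁻¹ • z) :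
    ∃ (M : ℕ) (Q : MvPolynomial (ChowIndex ι n) ℂ), Q.IsHomogeneous M ∧ eval z Q ≠ 0 ∧
      ∀ w : Fin n → ι → ℂ, eval (chow w) Q = 0 := by
  have h1 := mt (exists_chow_eq_of_relations u ((eval z (chowForm n u))⁻¹ • z)) (by simpa using h)
  push Not at h1
  obtain ⟨Q, hQ, hQz⟩ := h1
  obtain ⟨Q', hQ', hQ'z⟩ := exists_homogenization (isHomogeneous_chowForm (n := n) u) Q le_rfl
  refine ⟨_, chowForm n u * Q', (isHomogeneous_chowForm u).mul hQ', ?_, fun w => ?_⟩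
  · rw [map_mul, hQ'z z hz]
    exact mul_ne_zero hz (mul_ne_zero (pow_ne_zero _ hz) hQz)
  · rw [map_mul, eval_chowForm]
    by_cases h0 : formProd u w = 0
    · rw [h0, zero_mul]
    have hi : ∀ i, u ⬝ᵥ w i ≠ 0 := fun i => Finset.prod_ne_zero_iff.1 h0 i (Finset.mem_univ i)
    have h2 := hQ ⟨fun i => (u ⬝ᵥ w i)⁻¹ • w i, dotProduct_normalize hi⟩
    rw [hQ'z _ (by rwa [eval_chowForm]), eval_chowForm]
    simp only [chow_smul, Finset.prod_inv_distrib] at h2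
    change eval ((formProd u w)⁻¹ • _) _ = _ at h2
    rw [h2, mul_zero, mul_zero]

end Chow

/-! ### Tuples of points -/

section Tuples

variable {ι : Type} {n : ℕ}

/-- The other reorderings of a tuple of distinct points form a finite, hence closed, set that misses
the tuple. Such a form isolates one summand of an average over permutations. -/
theorem exists_separating_form {x : Fin n → PSpace ι} (hx : Function.Injective x)
    {U : Set (PSpace (Fin n → ι))} (hU : IsOpen U) (hxU : segrePow x ∈ U) :
    ∃ (H : MvPolynomial (Fin n → ι) ℂ) (d : ℕ), H.IsHomogeneous d ∧ segrePow x ∈ nonvanishing H ∧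
      nonvanishing H ⊆ U ∧ ∀ σ : Equiv.Perm (Fin n), σ ≠ 1 → segrePow (x ∘ σ) ∉ nonvanishing H := by
  set S := (fun σ : Equiv.Perm (Fin n) => segrePow (x ∘ σ)) '' {σ | σ ≠ 1} with hS
  have hSc : IsClosed S := isClosed_of_finite_pspace ((toFinite _).image _)
  have hxS : segrePow x ∉ S := by
    rintro ⟨σ, hσ, h⟩
    refine hσ (Equiv.ext fun i => hx ?_)
    exact congrFun (segrePow_injective h) i
  obtain ⟨H, d, hH, hxH, hHU⟩ := exists_nonvanishing (hU.inter hSc.isOpen_compl) ⟨hxU, hxS⟩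
  exact ⟨H, d, hH, hxH, fun p hp => (hHU hp).1, fun σ hσ h => (hHU h).2 ⟨σ, hσ, rfl⟩⟩

/-- The topology on tuples of points given by the Segre embedding. -/
abbrev segreTopology (n : ℕ) (ι : Type) : TopologicalSpace (Fin n → PSpace ι) :=
  .induced segrePow inferInstance

theorem isClosed_apply_mem (i : Fin n) {C : Set (PSpace ι)} (hC : IsClosed C) :
    IsClosed[segreTopology n ι] {x | x i ∈ C} := by
  obtain ⟨V, hV, h⟩ := (isRegular_segrePow_apply (ι := ι) i).exists_isOpen_iff hC.isOpen_compl
  refine isClosed_induced_iff.2 ⟨Vᶜ, hV.isClosed_compl, ?_⟩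
  ext x
  simp [h]

theorem isClosed_not_injective :
    IsClosed[segreTopology n ι] {x : Fin n → PSpace ι | ¬ Function.Injective x} := by
  let := segreTopology n ι
  have h : ∀ i l : Fin n, IsClosed {x : Fin n → PSpace ι | x i = x l} := by
    intro i l
    obtain ⟨V, hV, h⟩ := exists_isOpen_segrePow_ne (ι := ι) i l
    refine isClosed_induced_iff.2 ⟨Vᶜ, hV.isClosed_compl, ?_⟩
    ext x
    simp [h]
  have heq : {x : Fin n → PSpace ι | ¬ Function.Injective x} =
      ⋃ (i : Fin n) (l : Fin n), {x | x i = x l ∧ i ≠ l} := by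
    ext x
    simp [Function.Injective]
  rw [heq]
  refine isClosed_iUnion_of_finite fun i => isClosed_iUnion_of_finite fun l => ?_
  by_cases hil : i = l
  · simp [hil]
  · simpa [hil] using h i l

/-- The number of members of a tuple that belong to `C`. -/
def countIn (C : Set (PSpace ι)) (x : Fin n → PSpace ι) : ℕ := {i | x i ∈ C}.ncard

theorem countIn_comp_perm (C : Set (PSpace ι)) (x : Fin n → PSpace ι) (σ : Equiv.Perm (Fin n)) :
    countIn C (x ∘ σ) = countIn C x := by
  have : {i | x i ∈ C} = σ '' {i | (x ∘ σ) i ∈ C} := by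
    ext i
    simp [σ.image_eq_preimage_symm]
  rw [countIn, countIn, this, ncard_image_of_injective _ σ.injective]

/-- A finite union, over the sets of `k` indices, of closed conditions. Counting replaces conditions
on individual members by conditions stable under permutations. -/
theorem isClosed_le_countIn (k : ℕ) {C : Set (PSpace ι)} (hC : IsClosed C) :
    IsClosed[segreTopology n ι] {x | k ≤ countIn C x} := by
  let := segreTopology n ι
  have heq : {x : Fin n → PSpace ι | k ≤ countIn C x} =
      ⋃ s ∈ {s : Set (Fin n) | s.ncard = k}, ⋂ i ∈ s, {x | x i ∈ C} := by
    ext x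
    simp only [mem_ofPred_eq, mem_iUnion, mem_iInter, exists_prop]
    constructor
    · intro h
      obtain ⟨s, hs, hk⟩ := exists_subset_card_eq h
      exact ⟨s, hk, fun i hi => hs hi⟩
    · rintro ⟨s, rfl, h⟩
      exact ncard_le_ncard h
  rw [heq]
  exact (toFinite _).isClosed_biUnion fun s _ => isClosed_biInter fun i _ => isClosed_apply_mem i hC

theorem countIn_le (C : Set (PSpace ι)) (x : Fin n → PSpace ι) : countIn C x ≤ n := by
  simpa [countIn] using ncard_le_card {i | x i ∈ C}

theorem forall_mem_iff_le_countIn {C : Set (PSpace ι)} {x : Fin n → PSpace ι} :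
    (∀ i, x i ∈ C) ↔ n ≤ countIn C x := by
  have h := eq_univ_iff_ncard {i | x i ∈ C}
  rw [Nat.card_fin, eq_univ_iff_forall] at h
  exact h.trans ⟨fun h => h.ge, fun h => (countIn_le C x).antisymm h⟩

theorem exists_mem_iff_le_countIn {C : Set (PSpace ι)} {x : Fin n → PSpace ι} :
    (∃ i, x i ∈ C) ↔ 1 ≤ countIn C x := by
  rw [countIn, Nat.one_le_iff_ne_zero, ← Nat.pos_iff_ne_zero, ncard_pos]
  rfl

end Tuples

/-! ### The Chow map and descent along it -/

section ChowMap

variable {ι : Type} [Fintype ι] {n : ℕ}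

/-- The point with the Chow coordinates of a tuple of points. -/
def chowMap (x : Fin n → PSpace ι) : PSpace (ChowIndex ι n) :=
  PSpace.mk (chow fun i => (x i).coords) (chow_ne_zero fun i => (x i).coords_ne_zero)

theorem chowMap_eq (x : Fin n → PSpace ι) : chowMap x =
    PSpace.mk (chow fun i => (x i).coords) (chow_ne_zero fun i => (x i).coords_ne_zero) := rfl

theorem chowMap_mk {w : Fin n → ι → ℂ} (hw : ∀ i, w i ≠ 0) :
    chowMap (fun i => PSpace.mk (w i) (hw i)) = PSpace.mk _ (chow_ne_zero hw) := by
  choose a _ ha using fun i => PSpace.coords_mk (w i) (hw i)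
  rw [chowMap, PSpace.mk_eq_mk]
  exact ⟨∏ i, a i, by rw [← chow_smul]; simp only [ha]⟩

theorem chowMap_comp_perm (x : Fin n → PSpace ι) (σ : Equiv.Perm (Fin n)) :
    chowMap (x ∘ σ) = chowMap x := by
  rw [chowMap, chowMap, PSpace.mk_eq_mk]
  exact ⟨1, by rw [one_smul]; exact (chow_comp_perm (fun i => (x i).coords) σ).symm⟩

theorem isRegular_chowMap : IsRegular (segrePow : (Fin n → PSpace ι) → _) chowMap := by
  refine IsRegular.of_rep (fun x => pureTensor_ne_zero fun l => (x l).coords_ne_zero)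
    (fun x => rfl) (fun x => chow_ne_zero fun l => (x l).coords_ne_zero) (fun x => rfl) fun t =>
    ⟨1, fun e => ∑ m : Fin n → ι, C (∏ i, e.1 (m i)) * X m, univ,
      fun e => IsHomogeneous.sum _ _ _ fun m _ => isHomogeneous_C_mul_X _ _, isOpen_univ,
      mem_univ _, fun s _ => ⟨1, one_ne_zero, fun e => ?_⟩⟩
  rw [one_mul, chow, formProd_eq_sum, map_sum]
  simp only [map_mul, eval_C, eval_X]

theorem IsRegular.chowMap {T κ : Type} {j : T → PSpace κ} {f : Fin n → T → PSpace ι}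
    (hf : ∀ i, IsRegular j (f i)) : IsRegular j fun t => VarPairs.chowMap fun i => f i t :=
  IsRegular.comp (f := fun t i => f i t) isRegular_chowMap (IsRegular.segrePow hf)

/-- Averaging over the symmetric group. -/
theorem exists_averaged_forms {κ : Type} [Finite κ] {x : Fin n → PSpace ι}
    (hx : Function.Injective x) {U : Set (PSpace (Fin n → ι))} (hU : IsOpen U)
    (hxU : segrePow x ∈ U) {d : ℕ} {F : κ → MvPolynomial (Fin n → ι) ℂ}
    (hF : ∀ k, (F k).IsHomogeneous d) {k₀ : κ} (hk₀ : segrePow x ∈ nonvanishing (F k₀)) :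
    ∃ (M : ℕ) (Q : κ → MvPolynomial (ChowIndex ι n) ℂ), (∀ k, (Q k).IsHomogeneous M) ∧
      chowMap x ∈ nonvanishing (Q k₀) ∧
      ∀ y : Fin n → PSpace ι, ∃ b : Equiv.Perm (Fin n) → ℂ,
        (∀ σ, b σ ≠ 0 → segrePow (y ∘ σ) ∈ U) ∧
        ∀ k, eval (chow fun i => (y i).coords) (Q k) =
          ∑ σ, b σ * eval (pureTensor fun i => (y (σ i)).coords) (F k) := by
  obtain ⟨H, e, hH, hxH, hHU, hσ⟩ := exists_separating_form hx hU hxU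
  obtain ⟨u, hu⟩ := exists_dotProduct_ne_zero fun i => (x i).coords_ne_zero
  obtain ⟨M, r, Q, hQ, hQF⟩ := exists_symmetrization u fun k => hH.mul (hF k)
  -- The weight of `σ` is the value of the separating form `H` at the reordered tuple, times the
  -- power of `formProd u` produced by the symmetrization. At `x` only `σ = 1` contributes.
  refine ⟨M, Q, hQ, ?_, fun y => ⟨fun σ => formProd u (fun i => (y i).coords) ^ r *
    eval (pureTensor fun i => (y (σ i)).coords) H, fun σ h => hHU ?_, fun k => ?_⟩⟩
  · rw [chowMap_eq, mk_mem_nonvanishing (hQ k₀), hQF]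
    refine mul_ne_zero (pow_ne_zero _ (formProd_ne_zero hu)) ?_
    rw [Finset.sum_eq_single 1]
    · rw [map_mul]
      rw [segrePow_eq, mk_mem_nonvanishing hH] at hxH
      rw [segrePow_eq, mk_mem_nonvanishing (hF k₀)] at hk₀
      exact mul_ne_zero hxH hk₀
    · intro σ _ h1
      have := hσ σ h1
      rw [segrePow_eq, mk_mem_nonvanishing hH, not_not] at this
      rw [map_mul]
      exact mul_eq_zero_of_left this _
    · simp
  · rw [segrePow_eq, mk_mem_nonvanishing hH]
    exact right_ne_zero_of_mul h
  · rw [hQF, Finset.mul_sum]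
    refine Finset.sum_congr rfl fun σ _ => ?_
    rw [map_mul, ← mul_assoc]
    rfl

/-- The image of a closed set of tuples that is stable under permutations is closed, among the
images of the tuples of distinct points. -/
theorem exists_isClosed_chowMap {A : Set (Fin n → PSpace ι)} (hA : IsClosed[segreTopology n ι] A)
    (hperm : ∀ x ∈ A, ∀ σ : Equiv.Perm (Fin n), x ∘ σ ∈ A) :
    ∃ K : Set (PSpace (ChowIndex ι n)), IsClosed K ∧ (∀ x ∈ A, chowMap x ∈ K) ∧
      ∀ x, Function.Injective x → chowMap x ∈ K → x ∈ A := by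
  obtain ⟨B, hB, hBA⟩ := isClosed_induced_iff.1 hA
  have hmem : ∀ x, x ∈ A ↔ segrePow x ∈ B := fun x => by rw [← hBA]; rfl
  -- All reorderings of a member of `A` stay in `A`, so an average with weights supported off `B`
  -- vanishes on the image of `A`. For distinct points `x` outside `A` it can be chosen nonzero at
  -- `chowMap x`.
  refine ⟨closure (chowMap '' A), isClosed_closure, fun x hx => subset_closure ⟨x, hx, rfl⟩,
    fun x hx hcl => ?_⟩
  by_contra hxA
  obtain ⟨M, Q, hQ, hxQ, h⟩ := exists_averaged_forms (κ := Unit) hx hB.isOpen_compl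
    (fun h => hxA ((hmem x).2 h)) (F := fun _ => 1) (fun _ => isHomogeneous_one _ _) (k₀ := ())
    (by simp [nonvanishing])
  obtain ⟨_, hyQ, y, hy, rfl⟩ := mem_closure_iff.1 hcl _ (isOpen_nonvanishing (hQ ())) hxQ
  obtain ⟨b, hb, hbQ⟩ := h y
  rw [chowMap_eq, mk_mem_nonvanishing (hQ ()), hbQ] at hyQ
  refine hyQ (Finset.sum_eq_zero fun σ _ => ?_)
  by_cases hbσ : b σ = 0
  · rw [hbσ, zero_mul]
  · exact absurd ((hmem _).1 (hperm y hy σ)) (hb σ hbσ)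

/-- The orbit of `y` is finite, hence a closed stable set whose image separates it from other
tuples. Only `x` has to consist of distinct points. -/
theorem exists_perm_of_chowMap_eq {x y : Fin n → PSpace ι} (hx : Function.Injective x)
    (h : chowMap x = chowMap y) : ∃ σ : Equiv.Perm (Fin n), x = y ∘ σ := by
  have hA : IsClosed[segreTopology n ι] (range fun σ : Equiv.Perm (Fin n) => y ∘ σ) := by
    refine isClosed_induced_iff.2 ⟨range fun σ : Equiv.Perm (Fin n) => segrePow (y ∘ σ),
      isClosed_of_finite_pspace (finite_range _), ?_⟩
    ext z
    simp only [mem_preimage, mem_range]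
    exact exists_congr fun σ => ⟨fun h => segrePow_injective h, fun h => congrArg _ h⟩
  obtain ⟨K, -, hK, hK'⟩ := exists_isClosed_chowMap hA (by
    rintro _ ⟨τ, rfl⟩ σ
    exact ⟨τ * σ, rfl⟩)
  obtain ⟨σ, hσ⟩ := hK' x hx (h ▸ hK y ⟨1, rfl⟩)
  exact ⟨σ, hσ.symm⟩

/-- A map is regular if it comes from a regular map on tuples of distinct points. -/
theorem IsRegular.of_comp_chowMap {S T κ : Type} [Finite κ] {v : S → PSpace (ChowIndex ι n)}
    {j : T → Fin n → PSpace ι} {q : T → S} (hq : Function.Surjective q)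
    (hv : ∀ t, v (q t) = VarPairs.chowMap (j t)) (hj : ∀ t, Function.Injective (j t))
    (hperm : ∀ t (σ : Equiv.Perm (Fin n)), ∃ t', j t' = j t ∘ σ ∧ q t' = q t)
    {f : S → PSpace κ} (h : IsRegular (VarPairs.segrePow ∘ j) (f ∘ q)) : IsRegular v f := by
  intro s
  obtain ⟨t, rfl⟩ := hq s
  obtain ⟨d, F, U, hF, hU, ht, hFU⟩ := h t
  obtain ⟨h0, -⟩ := hFU t ht
  obtain ⟨k₀, hk₀⟩ := Function.ne_iff.1 h0
  obtain ⟨M, Q, hQ, htQ, hQb⟩ := exists_averaged_forms (hj t) hU ht hF hk₀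
  refine ⟨M, Q, nonvanishing (Q k₀), hQ, isOpen_nonvanishing (hQ k₀), by rwa [hv], fun s hs => ?_⟩
  obtain ⟨y, rfl⟩ := hq s
  obtain ⟨b, hb, hbQ⟩ := hQb (j y)
  -- A nonzero weight puts the reordered tuple into `U`, where `F` represents `f`, and the value of
  -- `f` is the same for all reorderings. So all summands are multiples of one vector, and their sum
  -- is nonzero because `Q k₀` does not vanish.
  have key : ∀ σ, ∃ c : ℂ, ∀ k, b σ * eval (pureTensor fun i => (j y (σ i)).coords) (F k) =
      c * (f (q y)).coords k := by
    intro σ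
    by_cases hbσ : b σ = 0
    · exact ⟨0, fun k => by rw [hbσ, zero_mul, zero_mul]⟩
    obtain ⟨y', hy', hqy'⟩ := hperm y σ
    have hU' := hb σ hbσ
    rw [← hy'] at hU'
    obtain ⟨h1, h2⟩ := hFU y' hU'
    rw [Function.comp_apply, hqy', ← (f (q y)).mk_coords, PSpace.mk_eq_mk] at h2
    obtain ⟨a, ha⟩ := h2
    obtain ⟨a', ha', hc⟩ := PSpace.coords_mk _
      (pureTensor_ne_zero fun i => (j y' i).coords_ne_zero)
    have ha0 : a ≠ 0 := by
      rintro rfl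
      rw [zero_smul] at ha
      exact (f (q y)).coords_ne_zero ha.symm
    refine ⟨b σ * (a * a' ^ d)⁻¹, fun k => ?_⟩
    have h3 := congrFun ha k
    rw [Pi.smul_apply, Function.comp_apply, segrePow_eq, hc, eval_smul_of_isHomogeneous (hF k),
      smul_eq_mul, hy'] at h3
    rw [← h3, mul_assoc, ← mul_assoc a, inv_mul_cancel_left₀ (mul_ne_zero ha0 (pow_ne_zero _ ha'))]
    rfl
  choose c hc using key
  have hQc : ∀ k, eval (chow fun i => (j y i).coords) (Q k) = (∑ σ, c σ) * (f (q y)).coords k := by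
    intro k
    rw [hbQ, Finset.sum_mul]
    exact Finset.sum_congr rfl fun σ _ => hc σ k
  refine exists_mk_eq_of_smul _ ((hv y).trans (chowMap_eq _)) hQ (f (q y)).coords_ne_zero
    (f (q y)).mk_coords.symm (a := ∑ σ, c σ) ?_ hQc
  intro h0
  rw [hv, chowMap_eq, mk_mem_nonvanishing (hQ k₀), hQc, h0, zero_mul] at hs
  exact hs rfl

/-- A point of the closure at which some `chowForm n u` is nonzero lies in the image: otherwise
integrality gives a form vanishing on the whole image but not at that point. -/
theorem isLocallyClosed_range_chowMap :
    IsLocallyClosed (range (chowMap : (Fin n → PSpace ι) → _)) := by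
  refine ⟨⋃ u : ι → ℂ, nonvanishing (chowForm n u), closure (range chowMap),
    isOpen_iUnion fun u => isOpen_nonvanishing (isHomogeneous_chowForm u), isClosed_closure,
    Subset.antisymm ?_ ?_⟩
  · rintro _ ⟨x, rfl⟩
    refine ⟨?_, subset_closure ⟨x, rfl⟩⟩
    obtain ⟨u, hu⟩ := exists_dotProduct_ne_zero fun i => (x i).coords_ne_zero
    rw [mem_iUnion]
    refine ⟨u, ?_⟩
    rw [chowMap_eq, mk_mem_nonvanishing (isHomogeneous_chowForm u), eval_chowForm]
    exact formProd_ne_zero hu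
  · rintro z ⟨hz, hcl⟩
    obtain ⟨u, hu⟩ := mem_iUnion.1 hz
    have hu' : eval z.coords (chowForm n u) ≠ 0 := hu
    by_contra hzr
    obtain ⟨M, Q, hQ, hzQ, hQ0⟩ := exists_form_vanishing_on_chow u hu' fun w hw => hzr <| by
      have hw0 : ∀ i, w.1 i ≠ 0 := fun i h => by
        have := w.2 i
        rw [h, dotProduct_zero] at this
        exact zero_ne_one this
      refine ⟨fun i => PSpace.mk (w.1 i) (hw0 i), ?_⟩
      rw [chowMap_mk]
      conv_rhs => rw [← z.mk_coords]
      rw [PSpace.mk_eq_mk]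
      exact ⟨_, hw.symm⟩
    obtain ⟨_, hyQ, y, rfl⟩ := mem_closure_iff.1 hcl _ (isOpen_nonvanishing hQ) hzQ
    rw [chowMap_eq, mk_mem_nonvanishing hQ] at hyQ
    exact hyQ (hQ0 _)

theorem exists_isClosed_le_countIn (k : ℕ) {C : Set (PSpace ι)} (hC : IsClosed C) :
    ∃ K : Set (PSpace (ChowIndex ι n)), IsClosed K ∧ (∀ x, k ≤ countIn C x → chowMap x ∈ K) ∧
      ∀ x, Function.Injective x → chowMap x ∈ K → k ≤ countIn C x :=
  exists_isClosed_chowMap (isClosed_le_countIn k hC) fun x hx σ =>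
    le_of_le_of_eq hx (countIn_comp_perm C x σ).symm

/-- The points of the configuration space of `n` distinct points of `X`. -/
def confSet (n : ℕ) (X : Set (PSpace ι)) : Set (PSpace (ChowIndex ι n)) :=
  chowMap '' {x | Function.Injective x ∧ ∀ i, x i ∈ X}

theorem isLocallyClosed_confSet (n : ℕ) {X : Set (PSpace ι)} (hX : IsLocallyClosed X) :
    IsLocallyClosed (confSet n X) := by
  obtain ⟨U, C, hU, hC, rfl⟩ := hX
  obtain ⟨K₁, hK₁, h₁, h₁'⟩ := exists_isClosed_chowMap (isClosed_not_injective (ι := ι) (n := n))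
    fun x hx σ h => hx (by simpa using h.comp σ.symm.injective)
  obtain ⟨K₂, hK₂, h₂, h₂'⟩ := exists_isClosed_le_countIn (n := n) n hC
  obtain ⟨K₃, hK₃, h₃, h₃'⟩ := exists_isClosed_le_countIn (n := n) 1 hU.isClosed_compl
  -- The sets `K₁`, `K₂`, `K₃` express that two points coincide, that all `n` points lie in `C`, and
  -- that some point lies outside `U`.
  have heq : confSet n (U ∩ C) = range chowMap ∩ (K₁ᶜ ∩ (K₂ ∩ K₃ᶜ)) := by
    ext z
    constructor
    · rintro ⟨x, ⟨hx, hxX⟩, rfl⟩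
      refine ⟨⟨x, rfl⟩, fun h => h₁' x hx h hx,
        h₂ x (forall_mem_iff_le_countIn.1 fun i => (hxX i).2), fun h => ?_⟩
      obtain ⟨i, hi⟩ := exists_mem_iff_le_countIn.2 (h₃' x hx h)
      exact hi (hxX i).1
    · rintro ⟨⟨x, rfl⟩, hz₁, hz₂, hz₃⟩
      have hx : Function.Injective x := by
        by_contra hx
        exact hz₁ (h₁ x hx)
      refine ⟨x, ⟨hx, fun i => ⟨?_, forall_mem_iff_le_countIn.2 (h₂' x hx hz₂) i⟩⟩, rfl⟩
      by_contra hi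
      exact hz₃ (h₃ x (exists_mem_iff_le_countIn.1 ⟨i, hi⟩))
  rw [heq]
  exact isLocallyClosed_range_chowMap.inter (hK₁.isOpen_compl.isLocallyClosed.inter
    (hK₂.isLocallyClosed.inter hK₃.isOpen_compl.isLocallyClosed))

/-- The configurations in `X` of which at least one point belongs to `Y`. -/
def confSubset (n : ℕ) (X Y : Set (PSpace ι)) : Set (PSpace (ChowIndex ι n)) :=
  chowMap '' {x | Function.Injective x ∧ (∀ i, x i ∈ X) ∧ ∃ i, x i ∈ Y}

/-- A tuple meets `U ∩ C` exactly when more of its points lie in `C` than in the closed set `C ∩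
Uᶜ`. Comparing both counts with the thresholds `k + 1 ≤ n` gives finitely many locally closed
conditions. -/
theorem isConstructibleSet_confSubset (n : ℕ) {X Y : Set (PSpace ι)} (hX : IsLocallyClosed X)
    (hY : IsConstructibleSet Y) : IsConstructibleSet (confSubset n X Y) := by
  obtain ⟨𝒮, hfin, hS, rfl⟩ := hY
  have hone : ∀ s ∈ 𝒮, IsConstructibleSet (confSubset n X s) := by
    intro s hs
    obtain ⟨U, C, hU, hC, rfl⟩ := hS s hs
    have hD : IsClosed (C ∩ Uᶜ) := hC.inter hU.isClosed_compl
    choose K hK h h' using fun k => exists_isClosed_le_countIn (n := n) k hC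
    choose L hL g g' using fun k => exists_isClosed_le_countIn (n := n) k hD
    refine ⟨(fun k => confSet n X ∩ (K (k + 1) ∩ (L (k + 1))ᶜ)) '' Iio n,
      (finite_Iio n).image _, ?_, ?_⟩
    · rintro _ ⟨k, -, rfl⟩
      exact (isLocallyClosed_confSet n hX).inter
        ((hK _).isLocallyClosed.inter (hL _).isOpen_compl.isLocallyClosed)
    · have hsub : ∀ x : Fin n → PSpace ι, {i | x i ∈ C ∩ Uᶜ} ⊆ {i | x i ∈ C} := fun x i hi => hi.1
      have key : ∀ x : Fin n → PSpace ι, (∃ i, x i ∈ U ∩ C) ↔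
          countIn (C ∩ Uᶜ) x < countIn C x := by
        intro x
        constructor
        · rintro ⟨i, hi⟩
          exact ncard_lt_ncard ⟨hsub x, fun h => (h (show x i ∈ C from hi.2)).2 hi.1⟩
        · intro hlt
          by_contra! hno
          refine hlt.not_ge (ncard_le_ncard fun i hi => ⟨hi, fun hU => hno i ⟨hU, hi⟩⟩)
      ext z
      simp only [sUnion_image, mem_iUnion, exists_prop]
      constructor
      · rintro ⟨k, hk, ⟨x, ⟨hx, hxX⟩, rfl⟩, hzK, hzL⟩
        refine ⟨x, ⟨hx, hxX, (key x).2 ?_⟩, rfl⟩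
        have h1 := h' _ x hx hzK
        have h2 := mt (g (k + 1) x) hzL
        omega
      · rintro ⟨x, ⟨hx, hxX, hxU⟩, rfl⟩
        have h1 := (key x).1 hxU
        have h3 := countIn_le C x
        refine ⟨countIn (C ∩ Uᶜ) x, ?_, ⟨x, ⟨hx, hxX⟩, rfl⟩, h _ x h1, fun hz => ?_⟩
        · rw [mem_Iio]
          omega
        · have := g' _ x hx hz
          omega
  have heq : confSubset n X (⋃₀ 𝒮) = ⋃ s ∈ 𝒮, confSubset n X s := by
    ext z
    simp only [confSubset, mem_image, mem_ofPred_eq, mem_sUnion, mem_iUnion, exists_prop]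
    constructor
    · rintro ⟨x, ⟨hx, hxX, i, s, hs, hi⟩, rfl⟩
      exact ⟨s, hs, x, ⟨hx, hxX, i, hi⟩, rfl⟩
    · rintro ⟨s, hs, x, ⟨hx, hxX, i, hi⟩, rfl⟩
      exact ⟨x, ⟨hx, hxX, i, s, hs, hi⟩, rfl⟩
  rw [heq]
  clear heq hS
  induction 𝒮, hfin using Set.Finite.induction_on with
  | empty => simpa using isConstructibleSet_empty
  | @insert s 𝒮 _ _ ih =>
    rw [biUnion_insert]
    exact (hone s (mem_insert _ _)).union (ih fun t ht => hone t (mem_insert_of_mem _ ht))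

end ChowMap

/-! ### Configuration spaces of pairs -/

attribute [instance] QPVariety.fin

section Configurations

variable {n : ℕ}

/-- The points of an ordered configuration, as points of the projective space. -/
def OrdConf.pts {V : QPVariety} (x : OrdConf n V) (i : Fin n) : PSpace V.ι := x.1 i

theorem OrdConf.pts_injective {V : QPVariety} (x : OrdConf n V) : Function.Injective x.pts :=
  Subtype.val_injective.comp x.2

theorem OrdConf.isRegular_apply {V : QPVariety} (i : Fin n) :
    IsRegular (OrdConf.val (n := n) (V := V)) (V.val ∘ fun x => x.1 i) :=
  (isRegular_segrePow_apply i).comp_right (OrdConf.pts (V := V))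

/-- The configuration of the images of the points under an injective map. -/
def OrdConf.map {U V : QPVariety} (g : U.X → V.X) (hg : Function.Injective g) (x : OrdConf n U) :
    OrdConf n V := ⟨g ∘ x.1, hg.comp x.2⟩

theorem OrdConf.isRegular_map {U V : QPVariety} {g : U.X → V.X} (hg : Function.Injective g)
    (h : IsRegular U.val (V.val ∘ g)) :
    IsRegular (OrdConf.val (n := n)) (OrdConf.val ∘ OrdConf.map g hg) :=
  IsRegular.segrePow (f := fun i (x : OrdConf n U) => V.val (g (x.1 i))) fun i =>
    h.comp (OrdConf.isRegular_apply i)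

variable (n) in
/-- The unordered configuration space of a pair, in Chow coordinates. -/
def confPair (P : VarPair) : VarPair where
  ι := ChowIndex P.ι n
  fin := inferInstance
  X := confSet n P.X
  isLocallyClosed := isLocallyClosed_confSet n P.isLocallyClosed
  Y := confSubset n P.X P.Y
  subset := by
    rintro _ ⟨x, ⟨hx, hxX, -⟩, rfl⟩
    exact ⟨x, ⟨hx, hxX⟩, rfl⟩
  isConstructible := isConstructibleSet_confSubset n P.isLocallyClosed P.isConstructible

/-- The projection from ordered to unordered configurations. -/
def confProj (P : VarPair) (x : OrdConf n P.toQPVariety) : (confPair n P).X :=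
  ⟨chowMap x.pts, x.pts, ⟨x.pts_injective, fun i => (x.1 i).2⟩, rfl⟩

theorem chowMap_mem_confPair_Y {P : VarPair} {x : Fin n → PSpace P.ι} (hx : Function.Injective x)
    (hxX : ∀ i, x i ∈ P.X) : chowMap x ∈ (confPair n P).Y ↔ ∃ i, x i ∈ P.Y := by
  constructor
  · rintro ⟨y, ⟨-, -, i, hi⟩, h⟩
    obtain ⟨σ, rfl⟩ := exists_perm_of_chowMap_eq hx h.symm
    exact ⟨σ.symm i, by simpa using hi⟩
  · exact fun h => ⟨x, ⟨hx, hxX, h⟩, rfl⟩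

theorem confProj_surjective (P : VarPair) :
    Function.Surjective (confProj P : OrdConf n P.toQPVariety → _) := by
  rintro ⟨_, x, ⟨hx, hxX⟩, rfl⟩
  exact ⟨⟨fun i => ⟨x i, hxX i⟩, fun i l h => hx (congrArg Subtype.val h)⟩, rfl⟩

theorem isConfigurationPair_confPair (n : ℕ) (P : VarPair) :
    IsConfigurationPair n P (confPair n P) := by
  have hproj : IsRegular OrdConf.val ((confPair n P).val ∘ confProj P) :=
    isRegular_chowMap.comp_right OrdConf.pts
  refine ⟨confProj P, ⟨confProj_surjective P, fun x y => ⟨fun h => ?_, ?_⟩,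
    fun W f => ⟨fun h => h.comp hproj, fun h => ?_⟩⟩, fun x => ?_⟩
  · obtain ⟨σ, hσ⟩ := exists_perm_of_chowMap_eq y.pts_injective (congrArg Subtype.val h).symm
    exact ⟨σ, funext fun i => Subtype.ext (congrFun hσ i)⟩
  · rintro ⟨σ, hσ⟩
    refine Subtype.ext ?_
    have : y.pts = x.pts ∘ σ := funext fun i => congrArg Subtype.val (congrFun hσ i)
    exact ((congrArg chowMap this).trans (chowMap_comp_perm _ σ)).symm
  · refine IsRegular.of_comp_chowMap (confProj_surjective P) (j := OrdConf.pts) (fun _ => rfl)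
      OrdConf.pts_injective (fun x σ => ⟨⟨x.1 ∘ σ, x.2.comp σ.injective⟩, rfl, ?_⟩) h
    exact Subtype.ext (chowMap_comp_perm x.pts σ)
  · exact chowMap_mem_confPair_Y x.pts_injective fun i => (x.1 i).2

/-- Two quotients of one set with the same fibres are in bijection. Regularity has to be checked
only for the map compatible with the projections. -/
theorem VarPair.iso_of_surjective {P Q : VarPair} {T : Type} {a : T → P.X} {b : T → Q.X}
    (ha : Function.Surjective a) (hb : Function.Surjective b) (hab : ∀ s t, a s = a t ↔ b s = b t)
    (h₁ : ∀ f : P.X → Q.X, f ∘ a = b → IsRegular P.val (Q.val ∘ f))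
    (h₂ : ∀ f : Q.X → P.X, f ∘ b = a → IsRegular Q.val (P.val ∘ f))
    (hY : ∀ t, (a t : PSpace P.ι) ∈ P.Y ↔ (b t : PSpace Q.ι) ∈ Q.Y) : P.Iso Q := by
  let e : P.X ≃ Q.X :=
    { toFun := fun z => b (Function.surjInv ha z)
      invFun := fun z => a (Function.surjInv hb z)
      left_inv := fun z => by
        conv_rhs => rw [← Function.surjInv_eq ha z]
        exact (hab _ _).2 (Function.surjInv_eq hb _)
      right_inv := fun z => by
        conv_rhs => rw [← Function.surjInv_eq hb z]
        exact (hab _ _).1 (Function.surjInv_eq ha _) }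
  have he : ∀ t, e (a t) = b t := fun t => (hab _ _).1 (Function.surjInv_eq ha _)
  refine ⟨e, h₁ e (funext he), h₂ e.symm (funext fun t => ?_), fun z => ?_⟩
  · rw [Function.comp_apply, ← he, Equiv.symm_apply_apply]
  · obtain ⟨t, rfl⟩ := ha z
    rw [hY, he]

/-- Each projection is regular, by `regular_iff` for the identity, and therefore descends along the
other one. -/
theorem IsConfigurationPair.unique {P Q Q' : VarPair} (h : IsConfigurationPair n P Q)
    (h' : IsConfigurationPair n P Q') : Q.Iso Q' := by
  obtain ⟨π, hπ, hY⟩ := h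
  obtain ⟨π', hπ', hY'⟩ := h'
  refine VarPair.iso_of_surjective hπ.surjective hπ'.surjective
    (fun x y => (hπ.eq_iff x y).trans (hπ'.eq_iff x y).symm)
    (fun f hf => (hπ.regular_iff Q'.toQPVariety f).2 ?_)
    (fun f hf => (hπ'.regular_iff Q.toQPVariety f).2 ?_) fun x => (hY x).trans (hY' x).symm
  · rw [hf]
    exact (hπ'.regular_iff Q'.toQPVariety id).1 (isRegular_self _)
  · rw [hf]
    exact (hπ.regular_iff Q.toQPVariety id).1 (isRegular_self _)

theorem IsConfigurationPair.of_iso {P P' Q : VarPair} (hP : P.Iso P')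
    (h : IsConfigurationPair n P Q) : IsConfigurationPair n P' Q := by
  obtain ⟨e, h1, h2, h3⟩ := hP
  obtain ⟨π, hπ, hY⟩ := h
  have hl : ∀ x : OrdConf n P.toQPVariety,
      OrdConf.map e.symm e.symm.injective (OrdConf.map e e.injective x) = x := fun x =>
    Subtype.ext (funext fun i => e.symm_apply_apply _)
  refine ⟨π ∘ OrdConf.map e.symm e.symm.injective, ⟨?_, fun x y => ?_, fun W f => ?_⟩, fun x => ?_⟩
  · exact hπ.surjective.comp fun x => ⟨_, hl x⟩
  · rw [Function.comp_apply, Function.comp_apply, hπ.eq_iff]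
    refine exists_congr fun σ => ?_
    change e.symm ∘ y.1 = e.symm ∘ (x.1 ∘ σ) ↔ _
    exact e.symm.injective.comp_left.eq_iff
  · rw [hπ.regular_iff]
    refine ⟨fun h => h.comp (OrdConf.isRegular_map e.symm.injective h2), fun h => ?_⟩
    have := h.comp (OrdConf.isRegular_map e.injective h1)
    convert this using 1
    funext x
    simp only [Function.comp_apply, hl]
  · rw [Function.comp_apply, hY]
    refine exists_congr fun i => ?_
    rw [h3]
    change (e (e.symm (x.1 i)) : PSpace P'.ι) ∈ _ ↔ _
    rw [e.apply_symm_apply]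

theorem confPair_iso {P P' : VarPair} (h : P.Iso P') : (confPair n P).Iso (confPair n P') :=
  ((isConfigurationPair_confPair n P).of_iso h).unique (isConfigurationPair_confPair n P')

/-- There is one empty tuple, even if `P` has no points, and it does not meet `P.Y`. This makes the
constant coefficient the unit. -/
theorem isConfigurationPair_zero (P : VarPair) : IsConfigurationPair 0 P VarPair.one := by
  have hsub : ∀ p q : PSpace Unit, p = q := fun p q => PSpace.eq_of_minors fun _ _ => rfl
  let p : PSpace Unit := PSpace.mk (fun _ => 1) (Function.ne_iff.2 ⟨(), one_ne_zero⟩)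
  let x : OrdConf 0 P.toQPVariety := ⟨Fin.elim0, fun i => i.elim0⟩
  have hconf : ∀ x y : OrdConf 0 P.toQPVariety, x = y := fun x y =>
    Subtype.ext (funext fun i => i.elim0)
  have hone : ∀ z w : VarPair.one.X, z = w := fun z w => Subtype.ext (hsub _ _)
  refine ⟨fun _ => ⟨p, trivial⟩, ⟨fun z => ⟨x, hone _ _⟩, fun x y => ?_, fun W f => ?_⟩,
    fun x => ?_⟩
  · exact iff_of_true rfl ⟨1, funext fun i => i.elim0⟩
  · have h1 : W.val ∘ f = fun _ => W.val (f ⟨p, trivial⟩) := funext fun z =>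
      congrArg (W.val ∘ f) (hone z _)
    refine iff_of_true ?_ (isRegular_const _ (W.val (f ⟨p, trivial⟩)))
    rw [h1]
    exact isRegular_const _ _
  · exact iff_of_false (fun h => h) (fun ⟨i, _⟩ => i.elim0)

theorem isConfigurationPair_one (P : VarPair) : IsConfigurationPair 1 P P := by
  refine ⟨fun x => x.1 0, ⟨fun z => ⟨⟨fun _ => z, fun _ _ _ => Subsingleton.elim _ _⟩, rfl⟩,
    fun x y => ?_, fun W f => ⟨fun h => h.comp (OrdConf.isRegular_apply 0), fun h => ?_⟩⟩,
    fun x => ?_⟩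
  · constructor
    · intro h
      refine ⟨1, funext fun i => ?_⟩
      rw [Subsingleton.elim i 0]
      exact h.symm
    · rintro ⟨σ, h⟩
      have := congrFun h 0
      rw [Function.comp_apply, Subsingleton.elim (σ 0) 0] at this
      exact this.symm
  · let g : P.X → OrdConf 1 P.toQPVariety := fun z =>
      ⟨fun _ => z, fun _ _ _ => Subsingleton.elim _ _⟩
    have hg : IsRegular P.val (OrdConf.val ∘ g) :=
      IsRegular.segrePow (f := fun _ z => P.val z) fun _ => isRegular_self _
    exact h.comp hg
  · constructor
    · exact fun h => ⟨0, h⟩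
    · rintro ⟨i, hi⟩
      rwa [Subsingleton.elim i 0] at hi

end Configurations

/-! ### Strata of configuration spaces -/

section Strata

theorem countIn_add {ι : Type} {k l : ℕ} (C : Set (PSpace ι)) (x : Fin (k + l) → PSpace ι) :
    countIn C x = countIn C (x ∘ Fin.castAdd l) + countIn C (x ∘ Fin.natAdd k) := by
  classical
  have h : ∀ {n : ℕ} (x : Fin n → PSpace ι), countIn C x = ∑ i, if x i ∈ C then 1 else 0 := by
    intro n x
    rw [countIn, ncard_eq_toFinset_card', ← Finset.card_filter]
    congr 1
    ext i
    simp
  rw [h, h, h, Fin.sum_univ_add]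
  rfl

theorem countIn_eq_zero {ι : Type} {n : ℕ} {C : Set (PSpace ι)} {x : Fin n → PSpace ι}
    (h : ∀ i, x i ∉ C) : countIn C x = 0 := by
  by_contra h0
  obtain ⟨i, hi⟩ := exists_mem_iff_le_countIn.2 (Nat.one_le_iff_ne_zero.2 h0)
  exact h i hi

theorem countIn_eq_iff {ι : Type} {k l : ℕ} {C : Set (PSpace ι)} {x : Fin (k + l) → PSpace ι}
    (h : ∀ i, x (Fin.natAdd k i) ∉ C) : countIn C x = k ↔ ∀ i, x (Fin.castAdd l i) ∈ C := by
  have h1 := forall_mem_iff_le_countIn (C := C) (x := x ∘ Fin.castAdd l)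
  have h2 := countIn_le C (x ∘ Fin.castAdd l)
  rw [countIn_add, countIn_eq_zero (x := x ∘ Fin.natAdd k) h, add_zero]
  exact ⟨fun h => h1.2 h.ge, fun h => h2.antisymm (h1.1 h)⟩

theorem exists_perm_of_countIn_eq {ι : Type} {k l : ℕ} {C : Set (PSpace ι)}
    {x : Fin (k + l) → PSpace ι} (h : countIn C x = k) :
    ∃ σ : Equiv.Perm (Fin (k + l)), (∀ i, x (σ (Fin.castAdd l i)) ∈ C) ∧
      ∀ i, x (σ (Fin.natAdd k i)) ∉ C := by
  classical
  have h1 : Fintype.card {i // x i ∈ C} = k := by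
    refine Eq.trans ?_ h
    rw [countIn, ncard_eq_toFinset_card', Fintype.card_subtype]
    congr 1
    ext i
    simp
  have h2 : Fintype.card {i // ¬ x i ∈ C} = l := by
    have := Fintype.card_subtype_compl fun i => x i ∈ C
    rw [this, h1, Fintype.card_fin, Nat.add_sub_cancel_left]
  let e₁ := (Fintype.equivFinOfCardEq h1).symm
  let e₂ := (Fintype.equivFinOfCardEq h2).symm
  refine ⟨finSumFinEquiv.symm.trans ((Equiv.sumCongr e₁ e₂).trans (Equiv.sumCompl _)),
    fun i => ?_, fun i => ?_⟩
  · simpa using (e₁ i).2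
  · simpa using (e₂ i).2

variable {ι : Type} [Fintype ι] {n k l : ℕ}

theorem chowMap_eq_of_forall_exists {x y : Fin n → PSpace ι} (hx : Function.Injective x)
    (h : ∀ i, ∃ m, x i = y m) : chowMap x = chowMap y := by
  choose τ hτ using h
  have hinj : Function.Injective τ := fun i j hij => hx (by rw [hτ, hτ, hij])
  have hxy : x = y ∘ Equiv.ofBijective τ (Finite.injective_iff_bijective.1 hinj) := funext hτ
  rw [hxy, chowMap_comp_perm]

/-- The Chow form of a concatenation is the product of the two Chow forms, and each factor is linear
in the Chow coordinates of its part. So the coordinates are linear in the Segre coordinates of the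
product. -/
theorem isRegular_chowMap_add :
    IsRegular (fun x : Fin (k + l) → PSpace ι =>
      segre (chowMap (x ∘ Fin.castAdd l)) (chowMap (x ∘ Fin.natAdd k))) chowMap := by
  refine IsRegular.of_rep (fun x => segre_aux
      (chow_ne_zero fun i => (x (Fin.castAdd l i)).coords_ne_zero)
      (chow_ne_zero fun i => (x (Fin.natAdd k i)).coords_ne_zero))
    (fun x => segre_mk _ _) (fun x => chow_ne_zero fun i => (x i).coords_ne_zero) (fun x => rfl)
    fun t => ⟨1, fun e => linForm fun ab =>
      ((exists_finset_formProd ι k).choose_spec e.1).choose ab.1 *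
      ((exists_finset_formProd ι l).choose_spec e.1).choose ab.2, univ,
      fun e => isHomogeneous_linForm _, isOpen_univ, mem_univ _,
      fun s _ => ⟨1, one_ne_zero, fun e => ?_⟩⟩
  have h1 := eval_chowForm e.1 fun i => (s (Fin.castAdd l i)).coords
  have h2 := eval_chowForm e.1 fun i => (s (Fin.natAdd k i)).coords
  rw [chowForm, eval_linForm, dotProduct] at h1 h2
  rw [one_mul, chow, formProd, Fin.prod_univ_add]
  change _ = formProd _ _ * formProd _ _
  rw [← h1, ← h2, eval_linForm, dotProduct, Fintype.sum_prod_type, Finset.sum_mul_sum]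
  refine Finset.sum_congr rfl fun a _ => Finset.sum_congr rfl fun b _ => ?_
  ring

/-- The configurations of `k + l` points of which exactly `k` belong to the closed set `C` form the
product of the configuration spaces of the two parts. -/
theorem prod_confPair_iso_restrict (P : VarPair) {C : Set (PSpace P.ι)} (hC : IsClosed C)
    {D : Set (PSpace (confPair (k + l) P).ι)} (hD : IsLocallyClosed D)
    (h : ∀ x : Fin (k + l) → PSpace P.ι, Function.Injective x →
      (chowMap x ∈ D ↔ countIn C x = k)) :
    ((confPair k (P.restrict C hC.isLocallyClosed)).prod
      (confPair l (P.restrict Cᶜ hC.isOpen_compl.isLocallyClosed))).Iso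
      ((confPair (k + l) P).restrict D hD) := by
  set P₁ := P.restrict C hC.isLocallyClosed with hP₁
  set P₂ := P.restrict Cᶜ hC.isOpen_compl.isLocallyClosed with hP₂
  -- Ordered representatives with the points of `C` in front. They surject onto both the product and
  -- the stratum, with the same fibres.
  let T := {x : Fin (k + l) → PSpace P.ι // Function.Injective x ∧ (∀ i, x i ∈ P.X) ∧
    (∀ i, x (Fin.castAdd l i) ∈ C) ∧ ∀ i, x (Fin.natAdd k i) ∉ C}
  have hleft : ∀ x : T, Function.Injective (x.1 ∘ Fin.castAdd l) := fun x =>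
    x.2.1.comp (Fin.castAdd_injective k l)
  have hright : ∀ x : T, Function.Injective (x.1 ∘ Fin.natAdd k) := fun x =>
    x.2.1.comp (Fin.natAdd_injective l k)
  have hleftX : ∀ x : T, ∀ i, (x.1 ∘ Fin.castAdd l) i ∈ P₁.X := fun x i =>
    ⟨x.2.2.1 _, x.2.2.2.1 i⟩
  have hrightX : ∀ x : T, ∀ i, (x.1 ∘ Fin.natAdd k) i ∈ P₂.X := fun x i =>
    ⟨x.2.2.1 _, x.2.2.2.2 i⟩
  let a : T → ((confPair k P₁).prod (confPair l P₂)).X := fun x =>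
    ⟨segre (chowMap (x.1 ∘ Fin.castAdd l)) (chowMap (x.1 ∘ Fin.natAdd k)),
      mem_image2_of_mem ⟨_, ⟨hleft x, hleftX x⟩, rfl⟩ ⟨_, ⟨hright x, hrightX x⟩, rfl⟩⟩
  let b : T → ((confPair (k + l) P).restrict D hD).X := fun x =>
    ⟨chowMap x.1, ⟨x.1, ⟨x.2.1, x.2.2.1⟩, rfl⟩,
      (h x.1 x.2.1).2 ((countIn_eq_iff x.2.2.2.2).2 x.2.2.2.1)⟩
  have ha : Function.Surjective a := by
    rintro ⟨_, _, ⟨x, ⟨hx, hxX⟩, rfl⟩, _, ⟨y, ⟨hy, hyX⟩, rfl⟩, rfl⟩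
    refine ⟨⟨Fin.append x y, Fin.append_injective_iff.2 ⟨hx, hy, fun i j hij => ?_⟩,
      fun i => ?_, fun i => ?_, fun i => ?_⟩, Subtype.ext ?_⟩
    · exact (hyX j).2 (hij ▸ (hxX i).2)
    · induction i using Fin.addCases with
      | left i => rw [Fin.append_left]; exact (hxX i).1
      | right i => rw [Fin.append_right]; exact (hyX i).1
    · rw [Fin.append_left]
      exact (hxX i).2
    · rw [Fin.append_right]
      exact (hyX i).2
    · change segre (chowMap (Fin.append x y ∘ Fin.castAdd l))
        (chowMap (Fin.append x y ∘ Fin.natAdd k)) = _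
      congr 2 <;> funext i <;> simp
  have hcover : ∀ x : Fin (k + l) → PSpace P.ι, Function.Injective x → (∀ i, x i ∈ P.X) →
      countIn C x = k → ∃ (σ : Equiv.Perm (Fin (k + l))) (t : T), t.1 = x ∘ σ := by
    intro x hx hxX hk
    obtain ⟨σ, h1, h2⟩ := exists_perm_of_countIn_eq hk
    exact ⟨σ, ⟨x ∘ σ, hx.comp σ.injective, fun i => hxX _, h1, h2⟩, rfl⟩
  have hb : Function.Surjective b := by
    rintro ⟨_, ⟨x, ⟨hx, hxX⟩, rfl⟩, hxD⟩
    obtain ⟨σ, t, ht⟩ := hcover x hx hxX ((h x hx).1 hxD)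
    refine ⟨t, Subtype.ext ?_⟩
    change chowMap t.1 = _
    rw [ht, chowMap_comp_perm]
  have hreg : IsRegular (Subtype.val ∘ a) (Subtype.val ∘ b) :=
    isRegular_chowMap_add.comp_right (Subtype.val : T → _)
  have hba : ∀ s t, b s = b t → a s = a t := by
    intro s t hst
    obtain ⟨σ, hσ⟩ := exists_perm_of_chowMap_eq s.2.1 (congrArg Subtype.val hst)
    refine Subtype.ext ?_
    change segre _ _ = segre _ _
    congr 1
    · refine chowMap_eq_of_forall_exists (hleft s) fun i => ?_
      have h1 := congrFun hσ (Fin.castAdd l i)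
      rw [Function.comp_apply] at h1
      generalize σ (Fin.castAdd l i) = m at h1
      induction m using Fin.addCases with
      | left m => exact ⟨m, h1⟩
      | right m => exact absurd (h1 ▸ s.2.2.2.1 i) (t.2.2.2.2 m)
    · refine chowMap_eq_of_forall_exists (hright s) fun i => ?_
      have h1 := congrFun hσ (Fin.natAdd k i)
      rw [Function.comp_apply] at h1
      generalize σ (Fin.natAdd k i) = m at h1
      induction m using Fin.addCases with
      | left m => exact absurd (h1 ▸ t.2.2.2.1 m) (s.2.2.2.2 i)
      | right m => exact ⟨m, h1⟩
  refine VarPair.iso_of_surjective ha hb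
    (fun s t => ⟨fun hst => ?_, hba s t⟩) (fun f hf => ?_) (fun f hf => ?_) fun t => ?_
  · exact Subtype.ext (hreg.eq_of_eq (congrArg Subtype.val hst))
  -- Composing with a set-theoretic section of `a` is enough, as `hreg` measures `b` against the
  -- coordinates of `a`.
  · have := hreg.comp_right (Function.surjInv ha)
    rw [Function.comp_assoc, Function.comp_assoc, ← hf, Function.comp_assoc,
      (Function.rightInverse_surjInv ha).comp_eq_id] at this
    exact this
  -- Descent along the Chow map needs a set stable under all permutations, which `T` is not; so all
  -- orderings are admitted.
  · let S := {x : Fin (k + l) → PSpace P.ι // Function.Injective x ∧ (∀ i, x i ∈ P.X) ∧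
      countIn C x = k}
    let q : S → ((confPair (k + l) P).restrict D hD).X := fun x =>
      ⟨chowMap x.1, ⟨x.1, ⟨x.2.1, x.2.2.1⟩, rfl⟩, (h x.1 x.2.1).2 x.2.2.2⟩
    refine IsRegular.of_comp_chowMap (q := q) (j := Subtype.val) ?_ (fun _ => rfl)
      (fun x => x.2.1) (fun x σ => ?_) (IsRegular.of_local fun x => ?_)
    · rintro ⟨_, ⟨x, ⟨hx, hxX⟩, rfl⟩, hxD⟩
      exact ⟨⟨x, hx, hxX, (h x hx).1 hxD⟩, rfl⟩
    · exact ⟨⟨x.1 ∘ σ, x.2.1.comp σ.injective, fun i => x.2.2.1 _,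
        (countIn_comp_perm C x.1 σ).trans x.2.2.2⟩, rfl, Subtype.ext (chowMap_comp_perm _ _)⟩
    -- `σ` brings the points of `C` to the front. That the last `l` points stay outside `C` is an
    -- open condition, and since exactly `k` points lie in `C` it forces the first `k` into `C`.
    · obtain ⟨σ, t, ht⟩ := hcover x.1 x.2.1 x.2.2.1 x.2.2.2
      choose V hV hVC using fun i : Fin l =>
        (isRegular_segrePow_apply (ι := P.ι) (σ (Fin.natAdd k i))).exists_isOpen_iff
          hC.isOpen_compl
      refine ⟨fun y => segre (chowMap (y.1 ∘ σ ∘ Fin.castAdd l)) (chowMap (y.1 ∘ σ ∘ Fin.natAdd k)),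
        ⋂ i, V i, ?_, isOpen_iInter_of_finite hV, mem_iInter.2 fun i => (hVC i _).2 ?_,
        fun y hy => ?_⟩
      · exact ((IsRegular.chowMap fun i => isRegular_segrePow_apply _).segre
          (IsRegular.chowMap fun i => isRegular_segrePow_apply _)).comp_right (Subtype.val : S → _)
      · have := t.2.2.2.2 i
        rw [ht] at this
        exact this
      · have hy' : ∀ i, y.1 (σ (Fin.natAdd k i)) ∉ C := fun i => (hVC i _).1 (mem_iInter.1 hy i)
        let s : T := ⟨y.1 ∘ σ, y.2.1.comp σ.injective, fun i => y.2.2.1 _,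
          (countIn_eq_iff (x := y.1 ∘ σ) hy').1 ((countIn_comp_perm C y.1 σ).trans y.2.2.2), hy'⟩
        have hq : q y = b s := Subtype.ext (chowMap_comp_perm _ _).symm
        change Subtype.val (f (q y)) = _
        rw [hq, ← Function.comp_apply (f := f), hf]
        rfl
  · change segre _ _ ∈ _ ↔ chowMap t.1 ∈ (confPair (k + l) P).Y ∩ D
    refine (VarPair.segre_mem_prod_Y (confPair k P₁) (confPair l P₂) _ _).trans (Iff.trans
      (or_congr ((and_iff_right ⟨_, ⟨hleft t, hleftX t⟩, rfl⟩).trans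
        (chowMap_mem_confPair_Y (P := P₂) (hright t) (hrightX t)))
        ((and_iff_left ⟨_, ⟨hright t, hrightX t⟩, rfl⟩).trans
        (chowMap_mem_confPair_Y (P := P₁) (hleft t) (hleftX t))))
      (Iff.trans ?_ ((and_iff_left (b t).2.2).trans
        (chowMap_mem_confPair_Y (P := P) t.2.1 t.2.2.1)).symm))
    constructor
    · rintro (⟨i, hi⟩ | ⟨i, hi⟩)
      exacts [⟨_, hi.1⟩, ⟨_, hi.1⟩]
    · rintro ⟨i, hi⟩
      induction i using Fin.addCases with
      | left i => exact Or.inr ⟨i, hi, t.2.2.2.1 i⟩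
      | right i => exact Or.inl ⟨i, hi, t.2.2.2.2 i⟩

end Strata

/-! ### Classes of configuration spaces in the Grothendieck ring -/

section Classes

theorem cls_eq_of_iso {P Q : VarPair} (h : P.Iso Q) : cls P = cls Q := by
  rw [cls, cls, PairClass.mk, PairClass.mk, Quotient.sound h]

/-- Weaker than equality of pairs: the `Fintype` instances on the index sets may differ, and `Iso`
does not involve them. -/
theorem VarPair.iso_of_eq {P Q : VarPair} (hι : Q.ι = P.ι) (hX : P.X = hι ▸ Q.X)
    (hY : P.Y = hι ▸ Q.Y) : P.Iso Q := by
  obtain ⟨⟨ι, X, hXc⟩, Y, hYX, hYc⟩ := P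
  obtain ⟨⟨ι', X', hXc'⟩, Y', hYX', hYc'⟩ := Q
  dsimp only at hι
  subst hι
  dsimp only at hX hY
  subst hX hY
  exact ⟨Equiv.refl _, isRegular_self _, isRegular_self _, fun _ => Iff.rfl⟩

theorem cls_prod (P Q : VarPair) : cls (P.prod Q) = cls P * cls Q := by
  rw [cls, cls, cls, ← map_mul, ← map_mul]
  rfl

theorem cls_one : cls VarPair.one = 1 := by
  rw [cls]
  exact (congrArg _ (map_one (MonoidAlgebra.of ℤ PairClass))).trans (map_one _)

theorem cls_eq_add (P : VarPair) {C : Set (PSpace P.ι)} (hC : IsClosed C) :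
    cls P = cls (P.restrict C hC.isLocallyClosed) +
      cls (P.restrict Cᶜ hC.isOpen_compl.isLocallyClosed) := by
  rw [cls, cls, cls, ← map_add, Ideal.Quotient.eq]
  exact Ideal.subset_span ⟨P, C, hC, rfl⟩

/-- Cut along the empty set, an empty pair falls into two copies of itself. -/
theorem cls_eq_zero_of_isEmpty {P : VarPair} (hP : P.X = ∅) : cls P = 0 := by
  have hY : P.Y = ∅ := subset_empty_iff.1 (hP ▸ P.subset)
  have h := cls_eq_add P isClosed_empty
  have h₁ : cls P = cls (P.restrict ∅ isClosed_empty.isLocallyClosed) :=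
    cls_eq_of_iso (VarPair.iso_of_eq rfl (by simp [hP]) (by simp [hY]))
  have h₂ : cls P = cls (P.restrict ∅ᶜ isClosed_empty.isOpen_compl.isLocallyClosed) :=
    cls_eq_of_iso (VarPair.iso_of_eq rfl (by simp [hP]) (by simp [hY]))
  rw [← h₁, ← h₂] at h
  exact left_eq_add.1 h

/-- The strata of the filtration are peeled off one at a time. The sets need to decrease only on
`P.X`, because the closed sets from the Chow map are controlled only at tuples of distinct points.
-/
theorem cls_eq_sum (P : VarPair) {K : ℕ → Set (PSpace P.ι)} (hK : ∀ k, IsClosed (K k))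
    (hmono : ∀ k, P.X ∩ K (k + 1) ⊆ K k) (h0 : P.X ⊆ K 0) {n : ℕ} (hn : P.X ∩ K n = ∅) :
    cls P = ∑ k ∈ Finset.range n, cls (P.restrict (K k ∩ (K (k + 1))ᶜ)
      ((hK k).isLocallyClosed.inter (hK (k + 1)).isOpen_compl.isLocallyClosed)) := by
  have key : ∀ m, cls P = ∑ k ∈ Finset.range m, cls (P.restrict (K k ∩ (K (k + 1))ᶜ)
      ((hK k).isLocallyClosed.inter (hK (k + 1)).isOpen_compl.isLocallyClosed)) +
      cls (P.restrict (K m) (hK m).isLocallyClosed) := by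
    intro m
    induction m with
    | zero =>
      rw [Finset.sum_range_zero, zero_add]
      exact cls_eq_of_iso (VarPair.iso_of_eq rfl (inter_eq_left.2 h0).symm
        (inter_eq_left.2 (P.subset.trans h0)).symm)
    | succ m ih =>
      rw [ih, Finset.sum_range_succ, add_assoc,
        cls_eq_add (P.restrict (K m) (hK m).isLocallyClosed) (hK (m + 1)), add_comm (cls _) (cls _)]
      congr 2
      · exact cls_eq_of_iso (VarPair.iso_of_eq rfl (inter_assoc _ _ _) (inter_assoc _ _ _))
      · refine cls_eq_of_iso (VarPair.iso_of_eq rfl ?_ ?_)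
        · change P.X ∩ K m ∩ K (m + 1) = P.X ∩ K (m + 1)
          rw [inter_right_comm]
          exact inter_eq_left.2 (hmono m)
        · change P.Y ∩ K m ∩ K (m + 1) = P.Y ∩ K (m + 1)
          rw [inter_right_comm]
          exact inter_eq_left.2 ((inter_subset_inter_left _ P.subset).trans (hmono m))
  rw [key n, cls_eq_zero_of_isEmpty hn, add_zero]

/-- Filter by the number of points in `C`. The stratum with exactly `k` of them is a product, and
level `n + 1` is empty since a tuple has only `n` members. -/
theorem cls_confPair_eq_sum (n : ℕ) (P : VarPair) {C : Set (PSpace P.ι)} (hC : IsClosed C) :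
    cls (confPair n P) = ∑ kl ∈ Finset.HasAntidiagonal.antidiagonal n,
      cls (confPair kl.1 (P.restrict C hC.isLocallyClosed)) *
      cls (confPair kl.2 (P.restrict Cᶜ hC.isOpen_compl.isLocallyClosed)) := by
  choose K hK h h' using fun k => exists_isClosed_le_countIn (n := n) k hC
  rw [cls_eq_sum (confPair n P) hK (n := n + 1), Finset.Nat.sum_antidiagonal_eq_sum_range_succ
    fun k l => cls (confPair k (P.restrict C hC.isLocallyClosed)) *
      cls (confPair l (P.restrict Cᶜ hC.isOpen_compl.isLocallyClosed))]
  · refine Finset.sum_congr rfl fun k hk => ?_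
    obtain ⟨l, rfl⟩ := Nat.exists_eq_add_of_le (Finset.mem_range_succ_iff.1 hk)
    rw [Nat.add_sub_cancel_left, ← cls_prod]
    refine (cls_eq_of_iso (prod_confPair_iso_restrict P hC _ fun x hx => ?_)).symm
    have h1 : chowMap x ∈ K k ↔ k ≤ countIn C x := ⟨h' k x hx, h k x⟩
    have h2 : chowMap x ∈ K (k + 1) ↔ k + 1 ≤ countIn C x := ⟨h' _ x hx, h _ x⟩
    refine (and_congr h1 (not_congr h2)).trans ?_
    omega
  · rintro k _ ⟨⟨x, ⟨hx, -⟩, rfl⟩, hz⟩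
    exact h k x ((Nat.le_succ k).trans (h' _ x hx hz))
  · rintro _ ⟨x, ⟨hx, -⟩, rfl⟩
    exact h 0 x (Nat.zero_le _)
  · rw [← subset_empty_iff]
    rintro _ ⟨⟨x, ⟨hx, -⟩, rfl⟩, hz⟩
    have h1 := h' _ x hx hz
    have h2 := countIn_le C x
    omega

/-- The series of the classes of the configuration spaces of a pair. -/
def confSeries (P : VarPair) : PowerSeries K0Pairs := PowerSeries.mk fun n => cls (confPair n P)

theorem coeff_zero_confSeries (P : VarPair) : PowerSeries.coeff 0 (confSeries P) = 1 := by
  rw [confSeries, PowerSeries.coeff_mk, ← cls_one]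
  exact cls_eq_of_iso ((isConfigurationPair_confPair 0 P).unique (isConfigurationPair_zero P))

theorem coeff_one_confSeries (P : VarPair) : PowerSeries.coeff 1 (confSeries P) = cls P := by
  rw [confSeries, PowerSeries.coeff_mk]
  exact cls_eq_of_iso ((isConfigurationPair_confPair 1 P).unique (isConfigurationPair_one P))

theorem isConfigurationSeries_iff {P : VarPair} {f : PowerSeries K0Pairs} :
    IsConfigurationSeries P f ↔ f = confSeries P := by
  constructor
  · rintro ⟨h0, h⟩
    ext n
    rcases n with _ | n
    · rw [h0, coeff_zero_confSeries]
    · obtain ⟨Q, hQ, hf⟩ := h (n + 1) (Nat.le_add_left 1 n)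
      rw [hf, confSeries, PowerSeries.coeff_mk]
      exact cls_eq_of_iso (hQ.unique (isConfigurationPair_confPair _ P))
  · rintro rfl
    exact ⟨coeff_zero_confSeries P, fun n _ => ⟨_, isConfigurationPair_confPair n P,
      PowerSeries.coeff_mk _ _⟩⟩

theorem confSeries_eq_of_iso {P Q : VarPair} (h : P.Iso Q) : confSeries P = confSeries Q := by
  ext n
  rw [confSeries, confSeries, PowerSeries.coeff_mk, PowerSeries.coeff_mk]
  exact cls_eq_of_iso (confPair_iso h)

theorem confSeries_eq_mul (P : VarPair) {C : Set (PSpace P.ι)} (hC : IsClosed C) :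
    confSeries P = confSeries (P.restrict C hC.isLocallyClosed) *
      confSeries (P.restrict Cᶜ hC.isOpen_compl.isLocallyClosed) := by
  ext n
  rw [PowerSeries.coeff_mul]
  simp only [confSeries, PowerSeries.coeff_mk]
  exact cls_confPair_eq_sum n P hC

end Classes

/-! ### The lambda structure -/

section Lambda

theorem isUnit_of_coeff_zero_eq_one {R : Type*} [CommRing R] {f : PowerSeries R}
    (hf : PowerSeries.coeff 0 f = 1) : IsUnit f := by
  rw [PowerSeries.isUnit_iff_constantCoeff, ← PowerSeries.coeff_zero_eq_constantCoeff_apply, hf]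
  exact isUnit_one

/-- The configuration series of an isomorphism class of pairs, as a unit. -/
def classSeries (c : PairClass) : (PowerSeries K0Pairs)ˣ :=
  Quotient.lift (fun P => (isUnit_of_coeff_zero_eq_one (coeff_zero_confSeries P)).unit)
    (fun _ _ h => Units.ext (confSeries_eq_of_iso h)) c

/-- The configuration series, extended to the free abelian group on the classes of pairs. -/
def freeSeries : MonoidAlgebra ℤ PairClass →+ Additive (PowerSeries K0Pairs)ˣ :=
  (Finsupp.liftAddHom (α := PairClass) (M := ℤ) (N := Additive (PowerSeries K0Pairs)ˣ) fun c =>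
     zmultiplesHom _ (Additive.ofMul (classSeries c))).comp
    MonoidAlgebra.coeffAddEquiv.toAddMonoidHom

theorem freeSeries_of (c : PairClass) :
    freeSeries (MonoidAlgebra.of ℤ PairClass c) = Additive.ofMul (classSeries c) := by
  refine (Finsupp.liftAddHom_apply_single _ c (1 : ℤ)).trans ?_
  rw [ zmultiplesHom_apply, one_zsmul]

theorem classSeries_restrict (P : VarPair) {C : Set (PSpace P.ι)} (hC : IsClosed C) :
    classSeries (PairClass.mk P) = classSeries (PairClass.mk (P.restrict C hC.isLocallyClosed)) *
      classSeries (PairClass.mk (P.restrict Cᶜ hC.isOpen_compl.isLocallyClosed)) :=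
  Units.ext (confSeries_eq_mul P hC)

theorem prod_restrict_iso (P Q : VarPair) {C : Set (PSpace Q.ι)} (hC : IsLocallyClosed C)
    {D : Set (PSpace (P.ι × Q.ι))} (hD : IsLocallyClosed D)
    (h : ∀ p q, segre p q ∈ D ↔ q ∈ C) :
    ((P.prod Q).restrict D hD).Iso (P.prod (Q.restrict C hC)) := by
  refine VarPair.iso_of_eq rfl ?_ ?_
  · ext z
    constructor
    · rintro ⟨⟨p, hp, q, hq, rfl⟩, hz⟩
      exact ⟨p, hp, q, ⟨hq, (h p q).1 hz⟩, rfl⟩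
    · rintro ⟨p, hp, q, hq, rfl⟩
      exact ⟨⟨p, hp, q, hq.1, rfl⟩, (h p q).2 hq.2⟩
  · ext z
    constructor
    · rintro ⟨⟨p, hp, q, hq, rfl⟩ | ⟨p, hp, q, hq, rfl⟩, hz⟩
      · exact Or.inl ⟨p, hp, q, ⟨hq, (h p q).1 hz⟩, rfl⟩
      · exact Or.inr ⟨p, hp, q, ⟨hq, (h p q).1 hz⟩, rfl⟩
    · rintro (⟨p, hp, q, hq, rfl⟩ | ⟨p, hp, q, hq, rfl⟩)
      · exact ⟨Or.inl ⟨p, hp, q, hq.1, rfl⟩, (h p q).2 hq.2⟩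
      · exact ⟨Or.inr ⟨p, hp, q, hq.1, rfl⟩, (h p q).2 hq.2⟩

/-- The preimage of `C` in the product is closed, so a class times a scissor relation is the scissor
relation of the product pair. -/
theorem classSeries_mul_restrict (c : PairClass) (P : VarPair) {C : Set (PSpace P.ι)}
    (hC : IsClosed C) : classSeries (c * PairClass.mk P) =
      classSeries (c * PairClass.mk (P.restrict C hC.isLocallyClosed)) *
      classSeries (c * PairClass.mk (P.restrict Cᶜ hC.isOpen_compl.isLocallyClosed)) := by
  obtain ⟨Q, rfl⟩ := Quotient.exists_rep c
  obtain ⟨U, hU, hUC⟩ := exists_isOpen_segre_right (ι := Q.ι) hC.isOpen_compl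
  have hD : IsClosed Uᶜ := hU.isClosed_compl
  have h₁ : PairClass.mk ((Q.prod P).restrict Uᶜ hD.isLocallyClosed) =
      PairClass.mk (Q.prod (P.restrict C hC.isLocallyClosed)) :=
    Quotient.sound (prod_restrict_iso Q P _ _ fun p q => by simp [hUC])
  have h₂ : PairClass.mk ((Q.prod P).restrict Uᶜᶜ hD.isOpen_compl.isLocallyClosed) =
      PairClass.mk (Q.prod (P.restrict Cᶜ hC.isOpen_compl.isLocallyClosed)) :=
    Quotient.sound (prod_restrict_iso Q P _ _ fun p q => by simp [hUC])
  have h := classSeries_restrict (Q.prod P) hD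
  rw [h₁, h₂] at h
  exact h

theorem freeSeries_mul_eq_zero {r : MonoidAlgebra ℤ PairClass} (hr : r ∈ scissorRelations)
    (a : MonoidAlgebra ℤ PairClass) : freeSeries (a * r) = 0 := by
  obtain ⟨P, C, hC, rfl⟩ := hr
  induction a using MonoidAlgebra.induction_on with
  | of c =>
    rw [mul_sub, mul_add, ← map_mul, ← map_mul, ← map_mul, map_sub, map_add, freeSeries_of,
      freeSeries_of, freeSeries_of, classSeries_mul_restrict c P hC, ofMul_mul, sub_self]
  | add a b ha hb => rw [add_mul, map_add, ha, hb, add_zero]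
  | smul m a ha => rw [smul_mul_assoc, map_zsmul, ha, smul_zero]

/-- `freeSeries` is only additive, so vanishing on generators does not by itself pass to the ideal;
the induction runs over the stronger claim for all multiples `a * r`. -/
theorem freeSeries_eq_zero {r : MonoidAlgebra ℤ PairClass}
    (hr : r ∈ Ideal.span scissorRelations) : freeSeries r = 0 := by
  suffices ∀ a, freeSeries (a * r) = 0 by simpa using this 1
  induction hr using Submodule.span_induction with
  | mem r hr => exact freeSeries_mul_eq_zero hr
  | zero => exact fun a => by rw [mul_zero, map_zero]
  | add x y _ _ hx hy => exact fun a => by rw [mul_add, map_add, hx, hy, add_zero]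
  | smul b x _ hx => exact fun a => by rw [smul_eq_mul, ← mul_assoc, hx]

/-- The lambda structure on the Grothendieck ring of pairs defined by configuration spaces. -/
def confLambda (a : K0Pairs) : PowerSeries K0Pairs :=
  ((freeSeries (Function.surjInv Ideal.Quotient.mk_surjective a)).toMul : (PowerSeries K0Pairs)ˣ)

/-- Two lifts differ by an element of the ideal, so the choice made by `surjInv` is immaterial. -/
theorem confLambda_mk (x : MonoidAlgebra ℤ PairClass) :
    confLambda (Ideal.Quotient.mk _ x) = ((freeSeries x).toMul : (PowerSeries K0Pairs)ˣ) := by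
  rw [confLambda]
  congr 2
  rw [← sub_eq_zero, ← map_sub]
  exact freeSeries_eq_zero (Ideal.Quotient.eq.1 (Function.surjInv_eq _ _))

theorem confLambda_cls (P : VarPair) : confLambda (cls P) = confSeries P := by
  rw [cls, confLambda_mk, freeSeries_of]
  rfl

theorem confLambda_add (a b : K0Pairs) : confLambda (a + b) = confLambda a * confLambda b := by
  obtain ⟨x, rfl⟩ := Ideal.Quotient.mk_surjective a
  obtain ⟨y, rfl⟩ := Ideal.Quotient.mk_surjective b
  rw [← map_add, confLambda_mk, confLambda_mk, confLambda_mk, map_add, toMul_add, Units.val_mul]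

/-- Classes of pairs are closed under products, so they generate the ring already as an additive
group. -/
theorem K0Pairs.induction {p : K0Pairs → Prop} (hcls : ∀ P, p (cls P)) (zero : p 0)
    (add : ∀ a b, p a → p b → p (a + b)) (neg : ∀ a, p a → p (-a)) (a : K0Pairs) : p a := by
  let S : AddSubgroup K0Pairs :=
    { carrier := {a | p a}
      add_mem' := fun ha hb => add _ _ ha hb
      zero_mem' := zero
      neg_mem' := fun ha => neg _ ha }
  change a ∈ S
  obtain ⟨x, rfl⟩ := Ideal.Quotient.mk_surjective a
  induction x using MonoidAlgebra.induction_on with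
  | of c =>
    obtain ⟨P, rfl⟩ := Quotient.exists_rep c
    exact hcls P
  | add x y hx hy => rw [map_add]; exact S.add_mem hx hy
  | smul m x hx =>
    rw [map_zsmul]
    exact S.zsmul_mem hx m

theorem confLambda_isUnit (a : K0Pairs) : IsUnit (confLambda a) := Units.isUnit _

theorem confLambda_zero : confLambda 0 = 1 := by
  have h := confLambda_add 0 0
  rw [add_zero] at h
  exact (confLambda_isUnit 0).mul_left_cancel (by rw [← h, mul_one])

theorem confLambda_mul_neg (a : K0Pairs) : confLambda a * confLambda (-a) = 1 := by
  rw [← confLambda_add, add_neg_cancel, confLambda_zero]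

theorem isLambdaStructure_confLambda : IsLambdaStructure confLambda := by
  have hmul₀ : ∀ f g : PowerSeries K0Pairs, PowerSeries.coeff 0 (f * g) =
      PowerSeries.coeff 0 f * PowerSeries.coeff 0 g := fun f g => by
    simp only [PowerSeries.coeff_zero_eq_constantCoeff_apply, map_mul]
  have h0 : ∀ a, PowerSeries.coeff 0 (confLambda a) = 1 := by
    intro a
    induction a using K0Pairs.induction with
    | hcls P => rw [confLambda_cls, coeff_zero_confSeries]
    | zero => rw [confLambda_zero, PowerSeries.coeff_zero_one]
    | add a b ha hb => rw [confLambda_add, hmul₀, ha, hb, one_mul]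
    | neg a ha =>
      have := congrArg (PowerSeries.coeff 0) (confLambda_mul_neg a)
      rwa [hmul₀, ha, one_mul, PowerSeries.coeff_zero_one] at this
  have hmul : ∀ a b, PowerSeries.coeff 1 (confLambda a * confLambda b) =
      PowerSeries.coeff 1 (confLambda a) + PowerSeries.coeff 1 (confLambda b) := by
    intro a b
    rw [PowerSeries.coeff_mul, Finset.Nat.antidiagonal_succ]
    simp [h0, add_comm]
  refine ⟨h0, fun a => ?_, confLambda_add⟩
  induction a using K0Pairs.induction with
  | hcls P => rw [confLambda_cls, coeff_one_confSeries]
  | zero => rw [confLambda_zero, PowerSeries.coeff_one, if_neg one_ne_zero]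
  | add a b ha hb => rw [confLambda_add, hmul, ha, hb]
  | neg a ha =>
    have := congrArg (PowerSeries.coeff 1) (confLambda_mul_neg a)
    rw [hmul, ha, PowerSeries.coeff_one, if_neg one_ne_zero] at this
    exact eq_neg_of_add_eq_zero_right this

/-- Both maps turn sums into products of units, so agreement on additive generators suffices. -/
theorem IsLambdaStructure.eq_confLambda {lam : K0Pairs → PowerSeries K0Pairs}
    (h : IsLambdaStructure lam) (hcls : ∀ P, lam (cls P) = confSeries P) : lam = confLambda := by
  have hunit : ∀ a, IsUnit (lam a) := fun a => isUnit_of_coeff_zero_eq_one (h.coeff_zero a)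
  have hzero : lam 0 = 1 := by
    have h0 := h.add 0 0
    rw [add_zero] at h0
    exact (hunit 0).mul_left_cancel (by rw [← h0, mul_one])
  funext a
  induction a using K0Pairs.induction with
  | hcls P => rw [hcls, confLambda_cls]
  | zero => rw [hzero, confLambda_zero]
  | add a b ha hb => rw [h.add, ha, hb, confLambda_add]
  | neg a ha =>
    refine (hunit a).mul_left_cancel ?_
    rw [← h.add, add_neg_cancel, hzero, ha, confLambda_mul_neg]

/-- On `P.X` the set `C₂` is the complement of the closed set `C₁`, so the decomposition is a
scissor cut. -/
theorem IsDisjointUnion.confSeries_eq {P P₁ P₂ : VarPair} (h : IsDisjointUnion P P₁ P₂) :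
    confSeries P = confSeries P₁ * confSeries P₂ := by
  obtain ⟨C₁, C₂, h₁, h₂, hcov, hdisj, hiso₁, hiso₂⟩ := h
  rw [confSeries_eq_mul P h₁, confSeries_eq_of_iso hiso₁, ← confSeries_eq_of_iso hiso₂]
  congr 1
  have hX : ∀ z ∈ P.X, z ∈ C₁ᶜ ↔ z ∈ C₂ := fun z hz =>
    ⟨fun h => (hcov hz).resolve_left h, fun h2 h1 => (hdisj ▸ ⟨⟨hz, h1⟩, h2⟩ : z ∈ (∅ : Set _))⟩
  refine confSeries_eq_of_iso (VarPair.iso_of_eq rfl ?_ ?_)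
  · ext z
    exact and_congr_right (hX z)
  · ext z
    exact and_congr_right fun hz => hX z (P.subset hz)

end Lambda

end VarPairs

end

/-! ### The theorem, assembled. -/

theorem mainTheorem3 :
    -- the configuration spaces exist as pairs of quasi-projective varieties and are unique
    (∀ (n : ℕ) (P : VarPairs.VarPair), ∃ Q, VarPairs.IsConfigurationPair n P Q) ∧
    (∀ (n : ℕ) (P Q Q' : VarPairs.VarPair), VarPairs.IsConfigurationPair n P Q →
      VarPairs.IsConfigurationPair n P Q' → Q.Iso Q') ∧
    -- the configuration series define one and only one lambda structure
    (∃! lam : VarPairs.K0Pairs → PowerSeries VarPairs.K0Pairs,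
      VarPairs.IsLambdaStructure lam ∧
      ∀ P, VarPairs.IsConfigurationSeries P (lam (VarPairs.cls P))) ∧
    -- the configuration series are multiplicative with respect to disjoint union
    (∀ (P P₁ P₂ : VarPairs.VarPair) (f f₁ f₂ : PowerSeries VarPairs.K0Pairs),
      VarPairs.IsDisjointUnion P P₁ P₂ → VarPairs.IsConfigurationSeries P f →
      VarPairs.IsConfigurationSeries P₁ f₁ → VarPairs.IsConfigurationSeries P₂ f₂ →
      f = f₁ * f₂) := by
  refine ⟨fun n P => ⟨_, VarPairs.isConfigurationPair_confPair n P⟩, fun n P Q Q' h h' => h.unique h',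
    ⟨VarPairs.confLambda, ⟨VarPairs.isLambdaStructure_confLambda, fun P => ?_⟩, ?_⟩,
    fun P P₁ P₂ f f₁ f₂ h hf hf₁ hf₂ => ?_⟩
  · exact VarPairs.isConfigurationSeries_iff.2 (VarPairs.confLambda_cls P)
  · rintro lam ⟨hlam, hcls⟩
    exact hlam.eq_confLambda fun P => VarPairs.isConfigurationSeries_iff.1 (hcls P)
  · rw [VarPairs.isConfigurationSeries_iff.1 hf, VarPairs.isConfigurationSeries_iff.1 hf₁,
      VarPairs.isConfigurationSeries_iff.1 hf₂, h.confSeries_eq]
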